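/- For positive integers $\chi,\Delta$, a $(\chi,\Delta)$-coloring of a finite simple graph $G=(V,E)$ is a function $c:V\to\{1,\dots,\chi\}$ such that, for every $i$, the subgraph of $G$ induced by $c^{-1}(i)$ has maximum degree at most $\Delta$. Defective Coloring is the problem of deciding, given $G$, $\chi$ and $\Delta$, whether $G$ admits a $(\chi,\Delta)$-coloring. A graph is chordal if it has no induced cycle of length four or more. Theorem. Defective Coloring can be solved in time $(\chi\Delta)^{O(\chi\Delta)}\,n^{O(1)}$ on chordal graphs with $n$ vertices. Precisely: there are a constant $C$ and a single deterministic random access machine program (unit cost; constants, addition, truncated subtraction and indirect addressing on natural-number registers, no multiplication) which, given $n$, $\chi\ge 1$, $\Delta\ge 1$ and the adjacency matrix of any chordal graph $G$ on $n$ vertices, halts after at most $C\,(\chi\Delta)^{C\chi\Delta}(n+1)^{C}$ steps and outputs $1$ if $G$ admits a $(\chi,\Delta)$-coloring and $0$ otherwise. -/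

import Mathlib

/-! ### A random access machine with structured control flow

The memory is an infinite array of registers, each holding a natural number.  Programs are finite
and independent of the input.  The operations are those of the classical random access machine
(constants, addition, truncated subtraction, direct and indirect access to registers), each charged
one unit of time.  There is no multiplication, so the values occurring in `t` steps have length
linear in `t` and in the length of the initial values, and the model is polynomially equivalent to
Turing machines. -/

namespace RAM

/-- The contents of all registers. -/
abbrev Memory := ℕ → ℕ

/-- Expressions; `reg e` is the content of the register whose address is the value of `e`. -/
inductive Expr : Type
  | const (k : ℕ)
  | reg (addr : Expr)
  | add (e₁ e₂ : Expr)
  | sub (e₁ e₂ : Expr)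

/-- The value of an expression in a given memory. -/
def Expr.eval (m : Memory) : Expr → ℕ
  | .const k => k
  | .reg a => m (a.eval m)
  | .add e₁ e₂ => e₁.eval m + e₂.eval m
  | .sub e₁ e₂ => e₁.eval m - e₂.eval m

/-- The time for evaluating an expression: one step for each constant, each register access
and each arithmetic operation. -/
def Expr.cost : Expr → ℕ
  | .const _ => 1
  | .reg a => a.cost + 1
  | .add e₁ e₂ => e₁.cost + e₂.cost + 1
  | .sub e₁ e₂ => e₁.cost + e₂.cost + 1

/-- Programs.  `store a e` writes the value of `e` into the register whose address is the value
of `a`; `ite e p q` runs `p` if the value of `e` is not zero and `q` otherwise; `loop e p` repeats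
`p` as long as the value of `e` is not zero. -/
inductive Program : Type
  | skip
  | store (a e : Expr)
  | seq (p q : Program)
  | ite (e : Expr) (p q : Program)
  | loop (e : Expr) (p : Program)

/-- `Runs p m t m'`: started with memory `m`, the program `p` halts after exactly `t` steps with
memory `m'`. -/
inductive Runs : Program → Memory → ℕ → Memory → Prop
  | skip (m : Memory) : Runs .skip m 1 m
  | store (a e : Expr) (m : Memory) :
      Runs (.store a e) m (a.cost + e.cost + 1) (Function.update m (a.eval m) (e.eval m))
  | seq {p q : Program} {m m' m'' : Memory} {t t' : ℕ} (hp : Runs p m t m') (hq : Runs q m' t' m'') :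
      Runs (.seq p q) m (t + t') m''
  | ite_true {e : Expr} {p q : Program} {m m' : Memory} {t : ℕ} (he : e.eval m ≠ 0)
      (hp : Runs p m t m') : Runs (.ite e p q) m (e.cost + 1 + t) m'
  | ite_false {e : Expr} {p q : Program} {m m' : Memory} {t : ℕ} (he : e.eval m = 0)
      (hq : Runs q m t m') : Runs (.ite e p q) m (e.cost + 1 + t) m'
  | loop_done {e : Expr} {p : Program} {m : Memory} (he : e.eval m = 0) :
      Runs (.loop e p) m (e.cost + 1) m
  | loop_step {e : Expr} {p : Program} {m m' m'' : Memory} {t t' : ℕ} (he : e.eval m ≠ 0)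
      (hp : Runs p m t m') (hl : Runs (.loop e p) m' t' m'') :
      Runs (.loop e p) m (e.cost + 1 + t + t') m''

/-- The machine is deterministic: running time and final memory are determined by the program and
the initial memory. -/
theorem Runs.deterministic {p : Program} {m m₁ m₂ : Memory} {t₁ t₂ : ℕ}
    (h₁ : Runs p m t₁ m₁) (h₂ : Runs p m t₂ m₂) : t₁ = t₂ ∧ m₁ = m₂ := by
  induction h₁ generalizing t₂ m₂ with
  | skip => cases h₂; exact ⟨rfl, rfl⟩
  | store => cases h₂; exact ⟨rfl, rfl⟩
  | seq _ _ ihp ihq =>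
    cases h₂ with
    | seq hp hq =>
      obtain ⟨rfl, rfl⟩ := ihp hp
      obtain ⟨rfl, rfl⟩ := ihq hq
      exact ⟨rfl, rfl⟩
  | ite_true he _ ih =>
    cases h₂ with
    | ite_true _ hp => obtain ⟨rfl, rfl⟩ := ih hp; exact ⟨rfl, rfl⟩
    | ite_false he' _ => exact absurd he' he
  | ite_false he _ ih =>
    cases h₂ with
    | ite_true he' _ => exact absurd he he'
    | ite_false _ hp => obtain ⟨rfl, rfl⟩ := ih hp; exact ⟨rfl, rfl⟩
  | loop_done he =>
    cases h₂ with
    | loop_done _ => exact ⟨rfl, rfl⟩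
    | loop_step he' _ _ => exact absurd he he'
  | loop_step he _ _ ihp ihl =>
    cases h₂ with
    | loop_done he' => exact absurd he' he
    | loop_step _ hp hl =>
      obtain ⟨rfl, rfl⟩ := ihp hp
      obtain ⟨rfl, rfl⟩ := ihl hl
      exact ⟨rfl, rfl⟩

end RAM

/-! ### Defective coloring and chordal graphs -/

namespace SimpleGraph

/-- A graph is chordal if it has no induced cycle of length four or more. -/
def IsChordalGraph {V : Type*} (G : SimpleGraph V) : Prop :=
  ∀ k : ℕ, 4 ≤ k → ¬ (cycleGraph k).IsIndContained G

open Classical in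
/-- `c` is a `(χ, Δ)`-coloring of `G`: each color class induces a subgraph of maximum degree at
most `Δ`. -/
def IsDefectiveColoring {V : Type*} [Fintype V] (G : SimpleGraph V) (χ Δ : ℕ)
    (c : V → Fin χ) : Prop :=
  ∀ i : Fin χ, (G.induce (c ⁻¹' {i})).maxDegree ≤ Δ

/-- `G` admits a `(χ, Δ)`-coloring. -/
def HasDefectiveColoring {V : Type*} [Fintype V] (G : SimpleGraph V) (χ Δ : ℕ) : Prop :=
  ∃ c : V → Fin χ, G.IsDefectiveColoring χ Δ c

open Classical in
/-- The input of Defective Coloring in the memory of the machine: the number `n` of vertices, the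
numbers `χ` and `Δ`, and then the adjacency matrix, row by row; all other registers are zero. -/
noncomputable def inputMemory {n : ℕ} (G : SimpleGraph (Fin n)) (χ Δ : ℕ) : RAM.Memory
  | 0 => n
  | 1 => χ
  | 2 => Δ
  | a + 3 => if ∃ u v : Fin n, a = u * n + v ∧ G.Adj u v then 1 else 0

end SimpleGraph

/-! By Dirac's theorem (`IsChordalGraph.exists_simplicial`) the vertices of a chordal graph can be
numbered so that every bag, a vertex together with its later neighbors, is a clique. Put K = χ(Δ +
1). In a (χ, Δ)-coloring a clique has at most Δ + 1 vertices of each color, hence at most K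
vertices. Color the vertices greedily and properly in reverse order and call the resulting number of
a vertex its slot. A vertex of slot q has at least q later neighbors, so if a (χ, Δ)-coloring
exists, then all slots are below K (`slot_lt`); otherwise the answer is no. The vertices of one bag
have different slots (`slot_injOn`). Hence an assignment of a color and of a count up to Δ to each
vertex of a bag is encoded by a number below S = K ^ K: the digit in base K at the slot of a vertex
is (Δ + 1) · color + count.

The dynamic program eliminates the vertices in order. The parent of v is its first later neighbor,
and the bag of the parent contains all later neighbors of v (`later_bag_par`). When v is eliminated,
what must be remembered is, for each later neighbor, its color and how many eliminated neighbors of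
that color have been recorded; this is added to the state of the parent. The load of a remaining
vertex, its remaining neighbors of the same color plus all recorded counts, does not change
(`load_merge`). Partial solutions can therefore be carried one step forward (`IsPartial.eliminate`)
and back (`IsPartial.introduce`), and a coloring exists if and only if every vertex without later
neighbors has a possible state when its turn comes (`DynamicProgram.correct`).

For the machine, every stage is a table with three indices below N = n + S + 1, whose entries are
given by expressions in earlier tables and earlier rows, with sums over all numbers below N. A fixed
list of such expressions compiles into one program that runs in time polynomial in N
(`exists_program`), and `time_bound` converts this into the required form. -/

namespace RAM

/-! ### Rules for proving time bounds of programs -/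

/-- Started with memory `m`, the program `P` halts within `T` steps in a memory satisfying `Q`. -/
def HaltsWithin (P : Program) (m : Memory) (T : ℕ) (Q : Memory → Prop) : Prop :=
  ∃ t m', Runs P m t m' ∧ t ≤ T ∧ Q m'

namespace HaltsWithin

theorem mono {P : Program} {m : Memory} {T T' : ℕ} {Q Q' : Memory → Prop}
    (h : HaltsWithin P m T Q) (hT : T ≤ T') (hQ : ∀ m', Q m' → Q' m') :
    HaltsWithin P m T' Q' := by
  obtain ⟨t, m', hr, ht, hq⟩ := h
  exact ⟨t, m', hr, ht.trans hT, hQ m' hq⟩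

theorem skip {m : Memory} {Q : Memory → Prop} (h : Q m) : HaltsWithin .skip m 1 Q :=
  ⟨1, m, .skip m, le_rfl, h⟩

theorem store {a e : Expr} {m : Memory} {Q : Memory → Prop}
    (h : Q (Function.update m (a.eval m) (e.eval m))) :
    HaltsWithin (.store a e) m (a.cost + e.cost + 1) Q :=
  ⟨_, _, .store a e m, le_rfl, h⟩

/-- The intermediate assertion is itself the claim that `q` halts, so a proof can follow a program
from the front without naming its intermediate states. -/
theorem seq {p q : Program} {m : Memory} {T₁ T₂ : ℕ} {Q : Memory → Prop}
    (h : HaltsWithin p m T₁ fun m' => HaltsWithin q m' T₂ Q) :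
    HaltsWithin (.seq p q) m (T₁ + T₂) Q := by
  obtain ⟨t, m', hr, ht, t', m'', hr', ht', hq⟩ := h
  exact ⟨t + t', m'', .seq hr hr', add_le_add ht ht', hq⟩

theorem ite {e : Expr} {p q : Program} {m : Memory} {T : ℕ} {Q : Memory → Prop}
    (hp : e.eval m ≠ 0 → HaltsWithin p m T Q) (hq : e.eval m = 0 → HaltsWithin q m T Q) :
    HaltsWithin (.ite e p q) m (e.cost + 1 + T) Q := by
  by_cases he : e.eval m = 0
  · obtain ⟨t, m', hr, ht, h⟩ := hq he
    exact ⟨_, m', .ite_false he hr, by omega, h⟩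
  · obtain ⟨t, m', hr, ht, h⟩ := hp he
    exact ⟨_, m', .ite_true he hr, by omega, h⟩

/-- A loop that makes exactly `k` iterations, with an invariant depending on the number of
iterations already made. -/
theorem loop {e : Expr} {p : Program} {T : ℕ} (Inv : ℕ → Memory → Prop) (k : ℕ)
    (hstep : ∀ i < k, ∀ m, Inv i m → e.eval m ≠ 0 ∧ HaltsWithin p m T (Inv (i + 1)))
    (hdone : ∀ m, Inv k m → e.eval m = 0) {m : Memory} (h0 : Inv 0 m) :
    HaltsWithin (.loop e p) m (k * (e.cost + 1 + T) + (e.cost + 1)) (Inv k) := by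
  suffices H : ∀ j i, i + j = k → ∀ m, Inv i m →
      HaltsWithin (.loop e p) m (j * (e.cost + 1 + T) + (e.cost + 1)) (Inv k) from
    H k 0 (by omega) m h0
  intro j
  induction j with
  | zero =>
    rintro i rfl m hm
    exact ⟨_, m, .loop_done (hdone m hm), by simp, hm⟩
  | succ j ih =>
    intro i hi m hm
    obtain ⟨he, t, m', hr, ht, hm'⟩ := hstep i (by omega) m hm
    obtain ⟨t', m'', hr', ht', hq⟩ := ih (i + 1) (by omega) m' hm'
    refine ⟨_, m'', .loop_step he hr hr', ?_, hq⟩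
    rw [Nat.succ_mul]
    omega

end HaltsWithin

/-! ### A language of tables -/

/-- The tables in memory; table `0` holds the input. -/
abbrev Tables := Fin 16 → ℕ → ℕ

/-- The values of the variables. -/
abbrev Env := Fin 32 → ℕ

/-- Expressions over variables and tables, with sums over all numbers below a fixed bound `N`. -/
inductive TExpr : Type
  | const (k : ℕ)
  | bound
  | var (v : Fin 32)
  | add (e₁ e₂ : TExpr)
  | sub (e₁ e₂ : TExpr)
  | mul (e₁ e₂ : TExpr)
  | tab (i : Fin 16) (e : TExpr)
  | ite (e e₁ e₂ : TExpr)
  | sum (v : Fin 32) (e : TExpr)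

/-- The value of an expression.  The first factor of a product is capped at `N`. -/
def TExpr.eval (N : ℕ) (𝕋 : Tables) : TExpr → Env → ℕ
  | .const k, _ => k
  | .bound, _ => N
  | .var v, ρ => ρ v
  | .add e₁ e₂, ρ => e₁.eval N 𝕋 ρ + e₂.eval N 𝕋 ρ
  | .sub e₁ e₂, ρ => e₁.eval N 𝕋 ρ - e₂.eval N 𝕋 ρ
  | .mul e₁ e₂, ρ => min (e₁.eval N 𝕋 ρ) N * e₂.eval N 𝕋 ρ
  | .tab i e, ρ => 𝕋 i (e.eval N 𝕋 ρ)
  | .ite e e₁ e₂, ρ => if e.eval N 𝕋 ρ ≠ 0 then e₁.eval N 𝕋 ρ else e₂.eval N 𝕋 ρ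
  | .sum v e, ρ => ∑ y ∈ Finset.range N, e.eval N 𝕋 (Function.update ρ v y)

/-- Statements: doing nothing, writing one table entry, sequencing, and loops over all numbers below `N`. -/
inductive TStmt : Type
  | skip
  | write (i : Fin 16) (a e : TExpr)
  | seq (s₁ s₂ : TStmt)
  | forall_ (v : Fin 32) (s : TStmt)

/-- The effect of a statement on the tables. -/
def TStmt.exec (N : ℕ) : TStmt → Env → Tables → Tables
  | .skip, _, 𝕋 => 𝕋
  | .write i a e, ρ, 𝕋 =>
      Function.update 𝕋 i (Function.update (𝕋 i) (a.eval N 𝕋 ρ) (e.eval N 𝕋 ρ))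
  | .seq s₁ s₂, ρ, 𝕋 => s₂.exec N ρ (s₁.exec N ρ 𝕋)
  | .forall_ v s, ρ, 𝕋 =>
      Nat.rec 𝕋 (fun y 𝕋' => s.exec N (Function.update ρ v y) 𝕋') N

/-- The register with number `a`. -/
abbrev Expr.cell (a : ℕ) : Expr := .reg (.const a)

/-- Write the value of `e` into the register with number `a`. -/
abbrev Program.set (a : ℕ) (e : Expr) : Program := .store (.const a) e

/-- Multiply the content of register `p` by `16`. -/
def Program.times16 (p : ℕ) : Program :=
  .seq (.set p (.add (.cell p) (.cell p))) <| .seq (.set p (.add (.cell p) (.cell p))) <|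
  .seq (.set p (.add (.cell p) (.cell p))) (.set p (.add (.cell p) (.cell p)))

/-- Compute the value of an expression into register `p`, using only registers from `p` on. -/
def TExpr.compile : TExpr → ℕ → Program
  | .const k, p => .set p (.const k)
  | .bound, p => .set p (.cell 4)
  | .var v, p => .set p (.cell (5 + v))
  | .add e₁ e₂, p => .seq (e₁.compile p) <| .seq (e₂.compile (p + 1)) <|
      .set p (.add (.cell p) (.cell (p + 1)))
  | .sub e₁ e₂, p => .seq (e₁.compile p) <| .seq (e₂.compile (p + 1)) <|
      .set p (.sub (.cell p) (.cell (p + 1)))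
  | .mul e₁ e₂, p => .seq (e₁.compile (p + 1)) <| .seq (e₂.compile (p + 2)) <|
      .seq (.set p (.const 0)) <|
      -- x - (x - N) = min x N. Multiplication is repeated addition, and the cap limits it to N
      -- rounds.
      .seq (.set (p + 1) (.sub (.cell (p + 1)) (.sub (.cell (p + 1)) (.cell 4)))) <|
      .loop (.cell (p + 1)) <| .seq (.set p (.add (.cell p) (.cell (p + 2)))) <|
        .set (p + 1) (.sub (.cell (p + 1)) (.const 1))
  | .tab i e, p => .seq (e.compile p) <| .seq (.times16 p) <|
      .set p (.reg (.add (.add (.cell 3) (.cell p)) (.const i)))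
  | .ite e e₁ e₂, p => .seq (e.compile p) <| .ite (.cell p) (e₁.compile p) (e₂.compile p)
  | .sum v e, p => .seq (.set p (.const 0)) <| .seq (.set (p + 1) (.cell (5 + v))) <|
      .seq (.set (5 + v) (.const 0)) <|
      .seq (.loop (.sub (.cell 4) (.cell (5 + v))) <| .seq (e.compile (p + 2)) <|
        .seq (.set p (.add (.cell p) (.cell (p + 2)))) <|
        .set (5 + v) (.add (.cell (5 + v)) (.const 1))) <|
      .set (5 + v) (.cell (p + 1))

/-- The number of scratch registers used by an expression. -/
def TExpr.space : TExpr → ℕ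
  | .const _ => 1
  | .bound => 1
  | .var _ => 1
  | .add e₁ e₂ => e₁.space + e₂.space + 1
  | .sub e₁ e₂ => e₁.space + e₂.space + 1
  | .mul e₁ e₂ => e₁.space + e₂.space + 2
  | .tab _ e => e.space
  | .ite e e₁ e₂ => e.space + e₁.space + e₂.space
  | .sum _ e => e.space + 2

/-- A bound for the time of evaluating an expression. -/
def TExpr.time (N : ℕ) : TExpr → ℕ
  | .const _ => 3
  | .bound => 4
  | .var _ => 4
  | .add e₁ e₂ => e₁.time N + e₂.time N + 7
  | .sub e₁ e₂ => e₁.time N + e₂.time N + 7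
  | .mul e₁ e₂ => e₁.time N + e₂.time N + N * 17 + 20
  | .tab _ e => e.time N + 38
  | .ite e e₁ e₂ => e.time N + e₁.time N + e₂.time N + 3
  | .sum _ e => N * (e.time N + 20) + 20

theorem TExpr.space_pos (e : TExpr) : 0 < e.space := by
  induction e <;> simp only [TExpr.space] <;> omega

/-- The compiled program: evaluate the address at `p`, the value at `p + 1`. -/
def TStmt.compile : TStmt → ℕ → Program
  | .skip, _ => .skip
  | .write i a e, p => .seq (a.compile p) <| .seq (e.compile (p + 1)) <| .seq (.times16 p) <|
      .store (.add (.add (.cell 3) (.cell p)) (.const i)) (.cell (p + 1))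
  | .seq s₁ s₂, p => .seq (s₁.compile p) (s₂.compile p)
  | .forall_ v s, p => .seq (.set p (.cell (5 + v))) <| .seq (.set (5 + v) (.const 0)) <|
      .seq (.loop (.sub (.cell 4) (.cell (5 + v))) <| .seq (s.compile (p + 1)) <|
        .set (5 + v) (.add (.cell (5 + v)) (.const 1))) <|
      .set (5 + v) (.cell p)

/-- The number of scratch registers used by a statement. -/
def TStmt.space : TStmt → ℕ
  | .skip => 0
  | .write _ a e => a.space + e.space + 1
  | .seq s₁ s₂ => s₁.space + s₂.space
  | .forall_ _ s => s.space + 1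

/-- A bound for the time of executing a statement. -/
def TStmt.time (N : ℕ) : TStmt → ℕ
  | .skip => 1
  | .write _ a e => a.time N + e.time N + 40
  | .seq s₁ s₂ => s₁.time N + s₂.time N
  | .forall_ _ s => N * (s.time N + 20) + 20

/-- The memory `m` holds the bound `N`, the tables (starting at register `B`) and the variables. -/
structure Represents (m : Memory) (B N : ℕ) (ρ : Env) (𝕋 : Tables) : Prop where
  base : m 3 = B
  bound : m 4 = N
  env (v : Fin 32) : m (5 + v) = ρ v
  tab (i : Fin 16) (a : ℕ) : m (B + 16 * a + i) = 𝕋 i a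

/-- Registers 5 to 36 hold the variables, and the tables are interleaved from B on. The registers
from 37 to B - 1 are scratch space and may change freely. -/
theorem Represents.congr {m m' : Memory} {B N : ℕ} {ρ : Env} {𝕋 : Tables}
    (h : Represents m B N ρ 𝕋) (h' : ∀ a, a < 37 ∨ B ≤ a → m' a = m a) :
    Represents m' B N ρ 𝕋 where
  base := by rw [h' _ (by omega), h.base]
  bound := by rw [h' _ (by omega), h.bound]
  env v := by rw [h' _ (by omega), h.env]
  tab i a := by rw [h' _ (by omega), h.tab]

theorem Represents.update_var {m m' : Memory} {B N : ℕ} {ρ : Env} {𝕋 : Tables}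
    (h : Represents m B N ρ 𝕋) (v : Fin 32) (y : ℕ) (hB : 37 ≤ B)
    (h' : ∀ a, a < 37 ∨ B ≤ a → a ≠ 5 + v → m' a = m a) (hv : m' (5 + v) = y) :
    Represents m' B N (Function.update ρ v y) 𝕋 where
  base := by rw [h' _ (by omega) (by omega), h.base]
  bound := by rw [h' _ (by omega) (by omega), h.bound]
  env w := by
    by_cases hw : w = v
    · subst hw; simp [hv]
    · rw [Function.update_of_ne hw, h' _ (by omega) (by omega), h.env]
  tab i a := by rw [h' _ (by omega) (by omega), h.tab]

theorem times16_halts {p : ℕ} {m : Memory} {Q : Memory → Prop}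
    (h : Q (Function.update m p (16 * m p))) : HaltsWithin (.times16 p) m 28 Q := by
  unfold Program.times16
  refine (HaltsWithin.seq (HaltsWithin.store (HaltsWithin.seq (HaltsWithin.store
    (HaltsWithin.seq (HaltsWithin.store (HaltsWithin.store ?_))))))).mono
    (by simp [Expr.cost]) fun _ h => h
  convert h using 1
  simp [Expr.eval]
  congr 1
  ring

/-- The scratch space is used as a stack: code compiled at p leaves every register below p unchanged
in the end, so an operand stored at p survives the evaluation of the next one at p + 1. A sum counts
in the register of its own variable and restores it afterwards; this register is therefore exempt
from the frame condition only inside the loop. -/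
theorem TExpr.compile_halts (e : TExpr) {B N : ℕ} {𝕋 : Tables} :
    ∀ {p : ℕ} {ρ : Env} {m : Memory}, Represents m B N ρ 𝕋 → 37 ≤ p → p + e.space ≤ B →
      HaltsWithin (e.compile p) m (e.time N) fun m' =>
        m' p = e.eval N 𝕋 ρ ∧ ∀ a, a < p ∨ B ≤ a → m' a = m a := by
  induction e with
  | const k =>
    intro p ρ m h hp hB
    simp only [space] at hB
    refine (HaltsWithin.store ?_).mono (by simp [Expr.cost, time]) fun _ h => h
    refine ⟨by simp [Expr.eval, eval], fun a ha => ?_⟩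
    simp only [Expr.eval]
    rw [Function.update_of_ne (by omega)]
  | bound =>
    intro p ρ m h hp hB
    simp only [space] at hB
    refine (HaltsWithin.store ?_).mono (by simp [Expr.cost, time]) fun _ h => h
    refine ⟨by simp [Expr.eval, eval, h.bound], fun a ha => ?_⟩
    simp only [Expr.eval]
    rw [Function.update_of_ne (by omega)]
  | var v =>
    intro p ρ m h hp hB
    simp only [space] at hB
    refine (HaltsWithin.store ?_).mono (by simp [Expr.cost, time]) fun _ h => h
    refine ⟨by simp [Expr.eval, eval, h.env], fun a ha => ?_⟩
    simp only [Expr.eval]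
    rw [Function.update_of_ne (by omega)]
  | add e₁ e₂ ih₁ ih₂ =>
    intro p ρ m h hp hB
    have h1 := e₁.space_pos
    have h2 := e₂.space_pos
    simp only [space] at hB
    refine (HaltsWithin.seq ((ih₁ h hp (by omega)).mono le_rfl ?_)).mono
      (T := e₁.time N + (e₂.time N + 7)) (by simp only [time]; omega) fun _ h => h
    rintro m₁ ⟨hm₁, hf₁⟩
    refine HaltsWithin.seq ((ih₂ (h.congr fun a ha => hf₁ a (by omega)) (by omega)
      (by omega)).mono le_rfl ?_)
    rintro m₂ ⟨hm₂, hf₂⟩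
    refine HaltsWithin.store ⟨?_, fun a ha => ?_⟩
    · simp only [Expr.eval, Function.update_self, eval]
      rw [hm₂, hf₂ p (by omega), hm₁]
    · simp only [Expr.eval]
      rw [Function.update_of_ne (by omega), hf₂ a (by omega), hf₁ a ha]
  | sub e₁ e₂ ih₁ ih₂ =>
    intro p ρ m h hp hB
    have h1 := e₁.space_pos
    have h2 := e₂.space_pos
    simp only [space] at hB
    refine (HaltsWithin.seq ((ih₁ h hp (by omega)).mono le_rfl ?_)).mono
      (T := e₁.time N + (e₂.time N + 7)) (by simp only [time]; omega) fun _ h => h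
    rintro m₁ ⟨hm₁, hf₁⟩
    refine HaltsWithin.seq ((ih₂ (h.congr fun a ha => hf₁ a (by omega)) (by omega)
      (by omega)).mono le_rfl ?_)
    rintro m₂ ⟨hm₂, hf₂⟩
    refine HaltsWithin.store ⟨?_, fun a ha => ?_⟩
    · simp only [Expr.eval, Function.update_self, eval]
      rw [hm₂, hf₂ p (by omega), hm₁]
    · simp only [Expr.eval]
      rw [Function.update_of_ne (by omega), hf₂ a (by omega), hf₁ a ha]
  | mul e₁ e₂ ih₁ ih₂ =>
    intro p ρ m h hp hB
    have h1 := e₁.space_pos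
    have h2 := e₂.space_pos
    simp only [space] at hB
    refine (HaltsWithin.seq ((ih₁ (p := p + 1) h (by omega) (by omega)).mono le_rfl ?_)).mono
      (T := e₁.time N + (e₂.time N + (3 + (10 + (N * 17 + 3)))))
      (by simp only [time]; omega) fun _ h => h
    rintro m₁ ⟨hm₁, hf₁⟩
    refine HaltsWithin.seq ((ih₂ (p := p + 2) (h.congr fun a ha => hf₁ a (by omega)) (by omega)
      (by omega)).mono le_rfl ?_)
    rintro m₂ ⟨hm₂, hf₂⟩
    refine HaltsWithin.seq (HaltsWithin.store (HaltsWithin.seq (HaltsWithin.store ?_)))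
    have hb : m₂ 4 = N := by rw [hf₂ _ (by omega), hf₁ _ (by omega), h.bound]
    have hx : m₂ (p + 1) = e₁.eval N 𝕋 ρ := by rw [hf₂ _ (by omega), hm₁]
    set x := e₁.eval N 𝕋 ρ with hxdef
    set y := e₂.eval N 𝕋 ρ with hydef
    refine (HaltsWithin.loop (T := 7 + 6) (fun i m' => m' p = i * y ∧ m' (p + 1) = min x N - i ∧
      m' (p + 2) = y ∧ ∀ a, a < p ∨ B ≤ a → m' a = m a) (min x N) ?_ ?_ ?_).mono ?_ ?_
    · rintro i hi m' ⟨i1, i2, i3, i4⟩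
      refine ⟨by simp only [Expr.eval]; omega, HaltsWithin.seq (HaltsWithin.store
        (HaltsWithin.store ?_))⟩
      simp only [Expr.eval]
      refine ⟨?_, ?_, ?_, fun a ha => ?_⟩
      · rw [Function.update_of_ne (by omega), Function.update_self, i1, i3]; ring
      · rw [Function.update_self, Function.update_of_ne (by omega), i2]; omega
      · rw [Function.update_of_ne (by omega), Function.update_of_ne (by omega), i3]
      · rw [Function.update_of_ne (by omega), Function.update_of_ne (by omega), i4 a ha]
    · rintro m' ⟨-, i2, -⟩
      simp only [Expr.eval]
      omega
    · simp only [Expr.eval]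
      refine ⟨?_, ?_, ?_, fun a ha => ?_⟩
      · rw [Function.update_of_ne (by omega), Function.update_self]; ring
      · rw [Function.update_self, Function.update_of_ne (by omega),
          Function.update_of_ne (by omega), hx, hb]
        omega
      · rw [Function.update_of_ne (by omega), Function.update_of_ne (by omega), hm₂]
      · rw [Function.update_of_ne (by omega), Function.update_of_ne (by omega),
          hf₂ a (by omega), hf₁ a (by omega)]
    · have : min x N ≤ N := min_le_right _ _
      simp only [Expr.cost]
      omega
    · rintro m' ⟨i1, -, -, i4⟩
      exact ⟨by rw [i1]; rfl, i4⟩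
  | tab i e ih =>
    intro p ρ m h hp hB
    have h1 := e.space_pos
    simp only [space] at hB
    refine (HaltsWithin.seq ((ih h hp (by omega)).mono le_rfl ?_)).mono
      (T := e.time N + (28 + 10)) (by simp only [time]; omega) fun _ h => h
    rintro m₁ ⟨hm₁, hf₁⟩
    refine HaltsWithin.seq (times16_halts ((HaltsWithin.store ?_).mono
      (by simp [Expr.cost]) fun _ h => h))
    simp only [Expr.eval]
    refine ⟨?_, fun a ha => ?_⟩
    · rw [Function.update_self, Function.update_self, Function.update_of_ne (by omega : 3 ≠ p),
        hf₁ 3 (by omega), h.base, hm₁, Function.update_of_ne (by omega), hf₁ _ (by omega), h.tab]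
      rfl
    · rw [Function.update_of_ne (by omega), Function.update_of_ne (by omega), hf₁ a ha]
  | ite e e₁ e₂ ih ih₁ ih₂ =>
    intro p ρ m h hp hB
    have h0 := e.space_pos
    have h1 := e₁.space_pos
    have h2 := e₂.space_pos
    simp only [space] at hB
    refine (HaltsWithin.seq ((ih h hp (by omega)).mono le_rfl ?_)).mono
      (T := e.time N + (3 + (e₁.time N + e₂.time N))) (by simp only [time]; omega) fun _ h => h
    rintro m₁ ⟨hm₁, hf₁⟩
    have h' : Represents m₁ B N ρ 𝕋 := h.congr fun a ha => hf₁ a (by omega)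
    refine HaltsWithin.ite (fun he => ?_) fun he => ?_
    · simp only [Expr.eval, hm₁] at he
      refine (ih₁ h' hp (by omega)).mono (by omega) ?_
      rintro m₂ ⟨hm₂, hf₂⟩
      exact ⟨by rw [hm₂, eval, if_pos he], fun a ha => by rw [hf₂ a ha, hf₁ a ha]⟩
    · simp only [Expr.eval, hm₁] at he
      refine (ih₂ h' hp (by omega)).mono (by omega) ?_
      rintro m₂ ⟨hm₂, hf₂⟩
      exact ⟨by rw [hm₂, eval, if_neg (by simp [he])], fun a ha => by rw [hf₂ a ha, hf₁ a ha]⟩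
  | sum v e ih =>
    intro p ρ m h hp hB
    have h1 := e.space_pos
    simp only [space] at hB
    have hv := v.isLt
    refine (HaltsWithin.seq (HaltsWithin.store (HaltsWithin.seq (HaltsWithin.store
      (HaltsWithin.seq (HaltsWithin.store (HaltsWithin.seq (T₁ := N * (6 + (e.time N + 13)) + 6)
      (T₂ := 4) ?_))))))).mono
      (by simp only [time, Expr.cost]; ring_nf; omega) fun _ h => h
    refine (HaltsWithin.loop (T := e.time N + (7 + 6)) (fun i m' =>
      m' p = ∑ y ∈ Finset.range i, e.eval N 𝕋 (Function.update ρ v y) ∧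
      m' (p + 1) = ρ v ∧ m' (5 + v) = i ∧ ∀ a, a < p ∨ B ≤ a → a ≠ 5 + v → m' a = m a)
      N ?_ ?_ ?_).mono (by simp [Expr.cost]) ?_
    · rintro i hi m' ⟨i1, i2, i3, i4⟩
      have hr : Represents m' B N (Function.update ρ v i) 𝕋 :=
        h.update_var v i (by omega) (fun a ha ha' => i4 a (by omega) ha') i3
      refine ⟨?_, HaltsWithin.seq ((ih hr (p := p + 2) (by omega) (by omega)).mono le_rfl ?_)⟩
      · simp only [Expr.eval]
        rw [hr.bound, i3]
        omega
      rintro m₂ ⟨hm₂, hf₂⟩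
      refine HaltsWithin.seq (HaltsWithin.store (HaltsWithin.store ?_))
      simp only [Expr.eval]
      refine ⟨?_, ?_, ?_, fun a ha ha' => ?_⟩
      · rw [Function.update_of_ne (by omega), Function.update_self, hm₂, hf₂ _ (by omega), i1,
          Finset.sum_range_succ]
      · rw [Function.update_of_ne (by omega), Function.update_of_ne (by omega),
          hf₂ _ (by omega), i2]
      · rw [Function.update_self, Function.update_of_ne (by omega), hf₂ _ (by omega), i3]
      · rw [Function.update_of_ne (by omega), Function.update_of_ne (by omega),
          hf₂ _ (by omega), i4 a ha ha']
    · rintro m' ⟨-, -, i3, i4⟩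
      simp only [Expr.eval]
      rw [i3, i4 4 (by omega) (by omega), h.bound]
      omega
    · simp only [Expr.eval]
      refine ⟨?_, ?_, ?_, fun a ha ha' => ?_⟩
      · rw [Function.update_of_ne (by omega), Function.update_of_ne (by omega),
          Function.update_self]
        simp
      · rw [Function.update_of_ne (by omega), Function.update_self,
          Function.update_of_ne (by omega), h.env]
      · rw [Function.update_self]
      · rw [Function.update_of_ne (by omega), Function.update_of_ne (by omega),
          Function.update_of_ne (by omega)]
    · rintro m' ⟨i1, i2, -, i4⟩
      refine (HaltsWithin.store ?_)
      simp only [Expr.eval]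
      refine ⟨?_, fun a ha => ?_⟩
      · rw [Function.update_of_ne (by omega), i1]
        rfl
      · by_cases ha' : a = 5 + v
        · rw [ha', Function.update_self, i2, h.env]
        · rw [Function.update_of_ne ha', i4 a ha ha']

theorem TStmt.compile_halts (s : TStmt) {B N : ℕ} :
    ∀ {p : ℕ} {ρ : Env} {𝕋 : Tables} {m : Memory}, Represents m B N ρ 𝕋 → 37 ≤ p →
      p + s.space ≤ B →
      HaltsWithin (s.compile p) m (s.time N) fun m' =>
        Represents m' B N ρ (s.exec N ρ 𝕋) ∧ ∀ a < p, m' a = m a := by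
  induction s with
  | skip => exact fun h _ _ => .skip ⟨h, fun _ _ => rfl⟩
  | write i e₁ e₂ =>
    intro p ρ 𝕋 m h hp hB
    have h1 := e₁.space_pos
    have h2 := e₂.space_pos
    have hi := i.isLt
    simp only [space] at hB
    refine (HaltsWithin.seq ((e₁.compile_halts h hp (by omega)).mono le_rfl ?_)).mono
      (T := e₁.time N + (e₂.time N + (28 + 10))) (by simp only [time]; omega) fun _ h => h
    rintro m₁ ⟨hm₁, hf₁⟩
    refine HaltsWithin.seq ((e₂.compile_halts (p := p + 1) (h.congr fun a ha => hf₁ a (by omega))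
      (by omega) (by omega)).mono le_rfl ?_)
    rintro m₂ ⟨hm₂, hf₂⟩
    refine HaltsWithin.seq (times16_halts ((HaltsWithin.store ?_).mono
      (by simp [Expr.cost]) fun _ h => h))
    have hf : ∀ a, a < p ∨ B ≤ a → m₂ a = m a := fun a ha => by
      rw [hf₂ a (by omega), hf₁ a ha]
    simp only [Expr.eval]
    rw [Function.update_self, Function.update_of_ne (by omega : 3 ≠ p),
      Function.update_of_ne (by omega : p + 1 ≠ p), hm₂, hf₂ p (by omega), hm₁,
      hf 3 (by omega), h.base]
    have hg : ∀ a, a < p → Function.update (Function.update m₂ p (16 * e₁.eval N 𝕋 ρ))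
        (B + 16 * e₁.eval N 𝕋 ρ + i) (e₂.eval N 𝕋 ρ) a = m a := fun a ha => by
      rw [Function.update_of_ne (by omega), Function.update_of_ne (by omega), hf a (by omega)]
    refine ⟨⟨?_, ?_, fun v => ?_, fun j a => ?_⟩, hg⟩
    · rw [hg _ (by omega), h.base]
    · rw [hg _ (by omega), h.bound]
    · rw [hg _ (by omega), h.env]
    · simp only [exec]
      by_cases hj : j = i
      · subst hj
        rw [Function.update_self]
        by_cases ha : a = e₁.eval N 𝕋 ρ
        · rw [ha, Function.update_self, Function.update_self]
        · rw [Function.update_of_ne (by omega), Function.update_of_ne (by omega),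
            Function.update_of_ne ha, hf _ (by omega), h.tab]
      · rw [Function.update_of_ne (by omega), Function.update_of_ne (by omega),
          Function.update_of_ne hj, hf _ (by omega), h.tab]
  | seq s₁ s₂ ih₁ ih₂ =>
    intro p ρ 𝕋 m h hp hB
    simp only [space] at hB
    refine HaltsWithin.seq ((ih₁ h hp (by omega)).mono le_rfl ?_)
    rintro m₁ ⟨hm₁, hf₁⟩
    refine (ih₂ hm₁ hp (by omega)).mono le_rfl ?_
    rintro m₂ ⟨hm₂, hf₂⟩
    exact ⟨hm₂, fun a ha => by rw [hf₂ a ha, hf₁ a ha]⟩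
  | forall_ v s ih =>
    intro p ρ 𝕋 m h hp hB
    simp only [space] at hB
    have hv := v.isLt
    refine (HaltsWithin.seq (HaltsWithin.store (HaltsWithin.seq (HaltsWithin.store
      (HaltsWithin.seq (T₁ := N * (6 + (s.time N + 6)) + 6) (T₂ := 4) ?_))))).mono
      (by simp only [time, Expr.cost]; ring_nf; omega) fun _ h => h
    refine (HaltsWithin.loop (T := s.time N + 6) (fun i m' =>
      Represents m' B N (Function.update ρ v i)
        (Nat.rec 𝕋 (fun y 𝕋' => s.exec N (Function.update ρ v y) 𝕋') i) ∧
      m' p = ρ v ∧ ∀ a, a < p → a ≠ 5 + v → m' a = m a)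
      N ?_ ?_ ?_).mono (by simp [Expr.cost]) ?_
    · rintro i hi m' ⟨i1, i2, i3⟩
      have hc : m' (5 + v) = i := by rw [i1.env]; simp
      refine ⟨?_, HaltsWithin.seq ((ih i1 (p := p + 1) (by omega) (by omega)).mono le_rfl ?_)⟩
      · simp only [Expr.eval]
        rw [i1.bound, hc]
        omega
      rintro m₂ ⟨hm₂, hf₂⟩
      refine HaltsWithin.store ?_
      simp only [Expr.eval]
      refine ⟨?_, ?_, fun a ha ha' => ?_⟩
      · have := hm₂.update_var v (i + 1) (by omega) (m' := Function.update m₂ (5 + v)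
          (m₂ (5 + v) + 1)) (fun a _ ha' => Function.update_of_ne ha' _ _) (by
            rw [Function.update_self, hm₂.env]; simp)
        simpa using this
      · rw [Function.update_of_ne (by omega), hf₂ _ (by omega), i2]
      · rw [Function.update_of_ne (by omega), hf₂ _ (by omega), i3 a ha ha']
    · rintro m' ⟨i1, -, -⟩
      simp only [Expr.eval]
      rw [i1.bound, i1.env]
      simp
    · simp only [Expr.eval]
      refine ⟨h.update_var v 0 (by omega) (fun a ha ha' => ?_) (by rw [Function.update_self]),
        ?_, fun a ha ha' => ?_⟩
      · rw [Function.update_of_ne ha', Function.update_of_ne (by omega)]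
      · rw [Function.update_of_ne (by omega), Function.update_self, h.env]
      · rw [Function.update_of_ne (by omega), Function.update_of_ne (by omega)]
    · rintro m' ⟨i1, i2, i3⟩
      refine (HaltsWithin.store ?_)
      simp only [Expr.eval]
      refine ⟨?_, fun a ha => ?_⟩
      · have := i1.update_var v (ρ v) (by omega) (m' := Function.update m' (5 + v)
          (m' p)) (fun a _ ha' => Function.update_of_ne ha' _ _) (by
            rw [Function.update_self, i2])
        rwa [Function.update_idem, Function.update_eq_self] at this
      · by_cases ha' : a = 5 + v
        · rw [ha', Function.update_self, i2, h.env]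
        · rw [Function.update_of_ne ha', i3 a ha ha']

end RAM

/-! ### Preparing the memory: moving the input and computing the parameters -/

namespace RAM

/-- Twice the value of an expression. -/
abbrev Expr.double (e : Expr) : Expr := .add e e

/-- Move the adjacency matrix away from the low registers: its entry number `a` goes to register
`B + 16 * a`, where the number `B = L + n * (n + 2)` is left in register `3`.  Diagonal entries of
the matrix serve as scratch registers. -/
def Program.relocate (L : ℕ) : Program :=
  .seq (.set 3 (.const L)) <|
  .seq (.store (.add (.cell 0) (.const 4)) (.cell 0)) <|
  .seq (.loop (.reg (.add (.cell 0) (.const 4))) <|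
    .seq (.set 3 (.add (.cell 3) (.add (.cell 0) (.const 2)))) <|
    .store (.add (.cell 0) (.const 4)) (.sub (.reg (.add (.cell 0) (.const 4))) (.const 1))) <|
  .seq (.store (.sub (.cell 3) (.const 1)) (.const 1)) <|
  .loop (.sub (.sub (.cell 3) (.const 4)) (.reg (.sub (.cell 3) (.const 1)))) <|
    .seq (.store
      (.add (.cell 3) (.double (.double (.double (.double (.reg (.sub (.cell 3) (.const 1))))))))
      (.reg (.add (.reg (.sub (.cell 3) (.const 1))) (.const 3)))) <|
    .store (.sub (.cell 3) (.const 1)) (.add (.reg (.sub (.cell 3) (.const 1))) (.const 1))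

theorem relocate_halts {L n χ Δ : ℕ} {inp : ℕ → ℕ} (hL : 37 ≤ L) {m : Memory}
    (h0 : m 0 = n) (h1 : m 1 = χ) (h2 : m 2 = Δ) (hm : ∀ a, m (a + 3) = inp a)
    (hinp0 : inp 0 = 0) (hinp1 : inp (n + 1) = 0) (hinp : ∀ a, n * n ≤ a → inp a = 0) :
    HaltsWithin (.relocate L) m (n * 50 + (L + n * (n + 2)) * 200 + 100) fun m' =>
      m' 0 = n ∧ m' 1 = χ ∧ m' 2 = Δ ∧ m' 3 = L + n * (n + 2) ∧
        ∀ a, m' (L + n * (n + 2) + 16 * a) = inp a := by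
  unfold Program.relocate
  refine (HaltsWithin.seq (HaltsWithin.store (HaltsWithin.seq (HaltsWithin.store
    (HaltsWithin.seq (T₁ := n * (5 + 1 + 30) + 6) (T₂ := 30 + ((L + n * (n + 2)) * (100 + 60) + 30))
      ?_))))).mono (by simp only [Expr.cost]; omega) fun _ h => h
  simp only [Expr.eval]
  refine (HaltsWithin.loop (T := 30) (fun i m' => m' 3 = L + i * (n + 2) ∧ m' (n + 4) = n - i ∧
      ∀ a, a ≠ 3 → a ≠ n + 4 → m' a = m a) n ?_ ?_ ?_).mono (by simp [Expr.cost]) ?_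
  · rintro i hi m' ⟨i1, i2, i3⟩
    have e0 : m' 0 = n := by rw [i3 0 (by omega) (by omega), h0]
    refine ⟨by simp only [Expr.eval]; rw [e0, i2]; omega, ?_⟩
    refine (HaltsWithin.seq (HaltsWithin.store (HaltsWithin.store ?_))).mono
      (by simp only [Expr.cost]; omega) fun _ h => h
    simp only [Expr.eval]
    rw [Function.update_of_ne (by omega : 0 ≠ 3), e0]
    refine ⟨?_, ?_, fun a ha ha' => ?_⟩
    · rw [Function.update_of_ne (by omega), Function.update_self, i1]; ring
    · rw [Function.update_self, Function.update_of_ne (by omega), i2]; omega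
    · rw [Function.update_of_ne (by omega), Function.update_of_ne (by omega), i3 a ha ha']
  · rintro m' ⟨-, i2, i3⟩
    simp only [Expr.eval]
    rw [i3 0 (by omega) (by omega), h0, i2]
    omega
  · rw [Function.update_of_ne (by omega : 0 ≠ 3), h0]
    refine ⟨?_, ?_, fun a ha ha' => ?_⟩
    · rw [Function.update_of_ne (by omega), Function.update_self]; ring
    · rw [Function.update_self]; omega
    · rw [Function.update_of_ne (by omega), Function.update_of_ne (by omega)]
  rintro m₁ ⟨i1, i2, i3⟩
  set B := L + n * (n + 2) with hB
  have hsq : n * (n + 2) = n * n + 2 * n := by ring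
  -- The counter in register n + 4 has run down to zero, which was its original content, so the
  -- matrix is intact except for register 3.
  have hf : ∀ a, a ≠ 3 → m₁ a = m a := fun a ha => by
    by_cases ha' : a = n + 4
    · rw [ha', i2, show n + 4 = (n + 1) + 3 by ring, hm, hinp1]; omega
    · exact i3 a ha ha'
  refine (HaltsWithin.seq (T₁ := 30) ((HaltsWithin.store ?_).mono
    (by simp only [Expr.cost]; omega) fun _ h => h))
  simp only [Expr.eval]
  rw [i1]
  -- The counter is in register B - 1, beyond the matrix, and starts at 1: entry 0, whose register
  -- now holds B, is zero, and so is its target. All targets are at B or above, so no source is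
  -- overwritten; the last entry moved has number B - 5, which is at least n².
  refine (HaltsWithin.loop (T := 140) (fun i m' => m' 3 = B ∧ m' (B - 1) = i + 1 ∧
      (∀ a, a ≠ 3 → a < B - 1 → m' a = m a) ∧ (∀ a < i + 1, m' (B + 16 * a) = inp a) ∧
      ∀ a, i + 1 ≤ a → m' (B + 16 * a) = 0) (B - 5) ?_ ?_ ?_).mono ?_ ?_
  · rintro i hi m' ⟨j1, j2, j3, j4, j5⟩
    refine ⟨by simp only [Expr.eval]; rw [j1, j2]; omega, ?_⟩
    refine (HaltsWithin.seq (HaltsWithin.store (HaltsWithin.store ?_))).mono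
      (by simp only [Expr.cost]; omega) fun _ h => h
    simp only [Expr.eval]
    rw [j1, j2, show B + (i + 1 + (i + 1) + (i + 1 + (i + 1)) + (i + 1 + (i + 1) + (i + 1 + (i + 1)))
      + (i + 1 + (i + 1) + (i + 1 + (i + 1)) + (i + 1 + (i + 1) + (i + 1 + (i + 1)))))
      = B + 16 * (i + 1) by ring, j3 (i + 1 + 3) (by omega) (by omega), hm,
      Function.update_of_ne (by omega : 3 ≠ B + 16 * (i + 1)), j1,
      Function.update_of_ne (by omega : B - 1 ≠ B + 16 * (i + 1)), j2]
    refine ⟨?_, ?_, fun a ha ha' => ?_, fun a ha => ?_, fun a ha => ?_⟩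
    · rw [Function.update_of_ne (by omega), Function.update_of_ne (by omega), j1]
    · rw [Function.update_self]
    · rw [Function.update_of_ne (by omega), Function.update_of_ne (by omega), j3 a ha ha']
    · rw [Function.update_of_ne (by omega)]
      by_cases hai : a = i + 1
      · rw [hai, Function.update_self]
      · rw [Function.update_of_ne (by omega), j4 a (by omega)]
    · rw [Function.update_of_ne (by omega), Function.update_of_ne (by omega), j5 a (by omega)]
  · rintro m' ⟨j1, j2, -⟩
    simp only [Expr.eval]
    rw [j1, j2]
    omega
  · have hz : ∀ a, m₁ (B + 16 * a) = 0 := fun a => by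
      rw [hf _ (by omega), show B + 16 * a = (B + 16 * a - 3) + 3 by omega, hm,
        hinp _ (by omega)]
    refine ⟨?_, ?_, fun a ha ha' => ?_, fun a ha => ?_, fun a ha => ?_⟩
    · rw [Function.update_of_ne (by omega), i1]
    · rw [Function.update_self]
    · rw [Function.update_of_ne (by omega), hf a ha]
    · rw [Function.update_of_ne (by omega), hz, show a = 0 by omega, hinp0]
    · rw [Function.update_of_ne (by omega), hz]
  · have : (B - 5) * (100 + 60) ≤ B * (100 + 60) := Nat.mul_le_mul_right _ (by omega)
    have : (B - 5) * (13 + 140) ≤ (B - 5) * (100 + 60) := Nat.mul_le_mul_left _ (by omega)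
    simp only [Expr.cost]
    omega
  · rintro m' ⟨j1, j2, j3, j4, j5⟩
    refine ⟨by rw [j3 0 (by omega) (by omega), h0], by rw [j3 1 (by omega) (by omega), h1],
      by rw [j3 2 (by omega) (by omega), h2], j1, fun a => ?_⟩
    by_cases ha : a < B - 5 + 1
    · exact j4 a ha
    · rw [j5 a (by omega), hinp a (by omega)]

/-- Set up the variables of the table language: `n`, `χ`, `Δ`, `K = χ * (Δ + 1)`, `S = K ^ K`,
`Δ + 1`, and the bound `N = n + S + 1`. -/
def Program.parameters : Program :=
  .seq (.set 5 (.cell 0)) <| .seq (.set 6 (.cell 1)) <| .seq (.set 7 (.cell 2)) <|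
  .seq (.set 10 (.add (.cell 2) (.const 1))) <| .seq (.set 8 (.const 0)) <|
  .seq (.set 12 (.cell 1)) <|
  .seq (.loop (.cell 12) <|
    .seq (.set 8 (.add (.cell 8) (.cell 10))) (.set 12 (.sub (.cell 12) (.const 1)))) <|
  .seq (.set 9 (.const 1)) <| .seq (.set 12 (.cell 8)) <|
  .seq (.loop (.cell 12) <|
    .seq (.set 13 (.const 0)) <| .seq (.set 14 (.cell 8)) <|
    -- K copies of the current power are added, so the cost is O(K) however large the power is.
    .seq (.loop (.cell 14) <|
      .seq (.set 13 (.add (.cell 13) (.cell 9))) (.set 14 (.sub (.cell 14) (.const 1)))) <|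
    .seq (.set 9 (.cell 13)) (.set 12 (.sub (.cell 12) (.const 1)))) <|
  .set 4 (.add (.cell 0) (.add (.cell 9) (.const 1)))

theorem parameters_halts {n χ Δ K S : ℕ} (hK : K = χ * (Δ + 1)) (hS : S = K ^ K) {m : Memory}
    (h0 : m 0 = n) (h1 : m 1 = χ) (h2 : m 2 = Δ) :
    HaltsWithin .parameters m (χ * 20 + K * (K * 20 + 40) + 100) fun m' =>
      m' 4 = n + S + 1 ∧ m' 5 = n ∧ m' 6 = χ ∧ m' 7 = Δ ∧ m' 8 = K ∧ m' 9 = S ∧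
        m' 10 = Δ + 1 ∧ m' 3 = m 3 ∧ ∀ a, 37 ≤ a → m' a = m a := by
  unfold Program.parameters
  refine (HaltsWithin.seq (HaltsWithin.store (HaltsWithin.seq (HaltsWithin.store
    (HaltsWithin.seq (HaltsWithin.store (HaltsWithin.seq (HaltsWithin.store
    (HaltsWithin.seq (HaltsWithin.store (HaltsWithin.seq (HaltsWithin.store
    (HaltsWithin.seq (T₁ := χ * 20 + 3) (T₂ := 20 + (K * (K * 20 + 40) + 3 + 20))
      ?_))))))))))))).mono (by simp only [Expr.cost]; omega) fun _ h => h
  simp only [Expr.eval]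
  refine (HaltsWithin.loop (T := 13) (fun i m' => m' 8 = i * (Δ + 1) ∧ m' 12 = χ - i ∧
      m' 5 = n ∧ m' 6 = χ ∧ m' 7 = Δ ∧ m' 10 = Δ + 1 ∧ m' 0 = n ∧ m' 3 = m 3 ∧
      ∀ a, 37 ≤ a → m' a = m a) χ ?_ ?_ ?_).mono (by simp only [Expr.cost]; omega) ?_
  · rintro i hi m' ⟨i1, i2, i3, i4, i5, i6, i7, i8, i9⟩
    refine ⟨by simp only [Expr.eval]; omega, (HaltsWithin.seq (HaltsWithin.store
      (HaltsWithin.store ?_))).mono (by simp only [Expr.cost]; omega) fun _ h => h⟩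
    simp only [Expr.eval]
    refine ⟨?_, ?_, ?_, ?_, ?_, ?_, ?_, ?_, fun a ha => ?_⟩
    · simp [i1, i6]; ring
    · simp [i2]; omega
    iterate 6 simp [*]
    · rw [Function.update_of_ne (by omega), Function.update_of_ne (by omega), i9 a ha]
  · rintro m' ⟨-, i2, -⟩
    simp only [Expr.eval]
    omega
  · refine ⟨by simp, by simp [h1], by simp [h0], by simp [h1], by simp [h2], by simp [h2],
      by simp [h0], by simp, fun a ha => ?_⟩
    iterate 6 rw [Function.update_of_ne (by omega)]
  rintro m₁ ⟨i1, i2, i3, i4, i5, i6, i7, i8, i9⟩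
  rw [← hK] at i1
  refine (HaltsWithin.seq (HaltsWithin.store (HaltsWithin.seq (HaltsWithin.store
    (HaltsWithin.seq (T₁ := K * (K * 20 + 40) + 3) (T₂ := 20) ?_))))).mono
    (by simp only [Expr.cost]; omega) fun _ h => h
  simp only [Expr.eval]
  refine (HaltsWithin.loop (T := K * 20 + 37) (fun i m' => m' 9 = K ^ i ∧ m' 12 = K - i ∧
      m' 8 = K ∧ m' 5 = n ∧ m' 6 = χ ∧ m' 7 = Δ ∧ m' 10 = Δ + 1 ∧ m' 0 = n ∧ m' 3 = m 3 ∧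
      ∀ a, 37 ≤ a → m' a = m a) K ?_ ?_ ?_).mono
      (by simp only [Expr.cost]; ring_nf; omega) ?_
  · rintro i hi m' ⟨j1, j2, j3, j4, j5, j6, j7, j8, j9, j10⟩
    refine ⟨by simp only [Expr.eval]; omega, (HaltsWithin.seq (HaltsWithin.store
      (HaltsWithin.seq (HaltsWithin.store (HaltsWithin.seq (T₁ := K * 20 + 3) (T₂ := 20)
      ?_))))).mono (by simp only [Expr.cost]; omega) fun _ h => h⟩
    simp only [Expr.eval]
    refine (HaltsWithin.loop (T := 13) (fun k m' => m' 13 = k * K ^ i ∧ m' 14 = K - k ∧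
      m' 9 = K ^ i ∧ m' 12 = K - i ∧
      m' 8 = K ∧ m' 5 = n ∧ m' 6 = χ ∧ m' 7 = Δ ∧ m' 10 = Δ + 1 ∧ m' 0 = n ∧ m' 3 = m 3 ∧
      ∀ a, 37 ≤ a → m' a = m a) K ?_ ?_ ?_).mono (by simp only [Expr.cost]; omega) ?_
    · rintro k hk m'' ⟨l1, l2, l3, l4, l5, l6, l7, l8, l9, l10, l11, l12⟩
      refine ⟨by simp only [Expr.eval]; omega, (HaltsWithin.seq (HaltsWithin.store
        (HaltsWithin.store ?_))).mono (by simp only [Expr.cost]; omega) fun _ h => h⟩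
      simp only [Expr.eval]
      refine ⟨?_, ?_, ?_, ?_, ?_, ?_, ?_, ?_, ?_, ?_, ?_, fun a ha => ?_⟩
      · simp [l1, l3]; ring
      · simp [l2]; omega
      iterate 9 simp [*]
      · rw [Function.update_of_ne (by omega), Function.update_of_ne (by omega), l12 a ha]
    · rintro m' ⟨-, i2, -⟩
      simp only [Expr.eval]
      omega
    · refine ⟨by simp, by simp [j3], ?_, ?_, ?_, ?_, ?_, ?_, ?_, ?_, ?_, fun a ha => ?_⟩
      iterate 9 simp [*]
      rw [Function.update_of_ne (by omega), Function.update_of_ne (by omega), j10 a ha]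
    · rintro m'' ⟨l1, l2, l3, l4, l5, l6, l7, l8, l9, l10, l11, l12⟩
      refine (HaltsWithin.seq (HaltsWithin.store
        (HaltsWithin.store ?_))).mono (by simp only [Expr.cost]; omega) fun _ h => h
      simp only [Expr.eval]
      refine ⟨?_, ?_, ?_, ?_, ?_, ?_, ?_, ?_, ?_, fun a ha => ?_⟩
      · simp [l1]; ring
      · simp [l4]; omega
      iterate 7 simp [*]
      · rw [Function.update_of_ne (by omega), Function.update_of_ne (by omega), l12 a ha]
  · rintro m' ⟨-, i2, -⟩
    simp only [Expr.eval]
    omega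
  · refine ⟨by simp, by simp [i1], ?_, ?_, ?_, ?_, ?_, ?_, ?_, fun a ha => ?_⟩
    iterate 7 simp [*]
    rw [Function.update_of_ne (by omega), Function.update_of_ne (by omega), i9 a ha]
  · rintro m'' ⟨j1, j2, j3, j4, j5, j6, j7, j8, j9, j10⟩
    rw [← hS] at j1
    refine (HaltsWithin.store ?_).mono (by simp only [Expr.cost]; omega) fun _ h => h
    simp only [Expr.eval]
    refine ⟨?_, ?_, ?_, ?_, ?_, ?_, ?_, ?_, fun a ha => ?_⟩
    iterate 8 simp [*, add_assoc]
    · rw [Function.update_of_ne (by omega), j10 a ha]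

end RAM

/-! ### Polynomial running time of table programs -/

namespace RAM

/-- `f` is bounded by a polynomial. -/
def PolyBounded (f : ℕ → ℕ) : Prop :=
  ∃ c, ∀ N, f N ≤ c * (N + 1) ^ c

namespace PolyBounded

theorem const (k : ℕ) : PolyBounded fun _ => k :=
  ⟨k, fun _ => Nat.le_mul_of_pos_right _ (by positivity)⟩

theorem id : PolyBounded fun N => N :=
  ⟨1, fun N => by simp⟩

theorem add {f g : ℕ → ℕ} (hf : PolyBounded f) (hg : PolyBounded g) :
    PolyBounded fun N => f N + g N := by
  obtain ⟨c, hc⟩ := hf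
  obtain ⟨d, hd⟩ := hg
  refine ⟨c + d, fun N => ?_⟩
  calc f N + g N ≤ c * (N + 1) ^ c + d * (N + 1) ^ d := add_le_add (hc N) (hd N)
    _ ≤ c * (N + 1) ^ (c + d) + d * (N + 1) ^ (c + d) := by gcongr <;> omega
    _ = _ := by ring

theorem mul {f g : ℕ → ℕ} (hf : PolyBounded f) (hg : PolyBounded g) :
    PolyBounded fun N => f N * g N := by
  obtain ⟨c, hc⟩ := hf
  obtain ⟨d, hd⟩ := hg
  refine ⟨c * d + c + d, fun N => ?_⟩
  calc f N * g N ≤ (c * (N + 1) ^ c) * (d * (N + 1) ^ d) := Nat.mul_le_mul (hc N) (hd N)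
    _ = (c * d) * (N + 1) ^ (c + d) := by ring
    _ ≤ _ := by gcongr <;> omega

end PolyBounded

/-- The expression is fixed, and each level of nested sums contributes one factor N; the degree is
governed by the nesting depth. -/
theorem TExpr.polyBounded_time (e : TExpr) : PolyBounded fun N => e.time N := by
  induction e with
  | const k => exact .const 3
  | bound => exact .const 4
  | var v => exact .const 4
  | add e₁ e₂ h₁ h₂ => exact (h₁.add h₂).add (.const 7)
  | sub e₁ e₂ h₁ h₂ => exact (h₁.add h₂).add (.const 7)
  | mul e₁ e₂ h₁ h₂ => exact ((h₁.add h₂).add (PolyBounded.id.mul (.const 17))).add (.const 20)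
  | tab i e h => exact h.add (.const 38)
  | ite e e₁ e₂ h h₁ h₂ => exact ((h.add h₁).add h₂).add (.const 3)
  | sum v e h => exact (PolyBounded.id.mul (h.add (.const 20))).add (.const 20)

theorem TStmt.polyBounded_time (s : TStmt) : PolyBounded fun N => s.time N := by
  induction s with
  | skip => exact .const 1
  | write i a e => exact (a.polyBounded_time.add e.polyBounded_time).add (.const 40)
  | seq s₁ s₂ h₁ h₂ => exact h₁.add h₂
  | forall_ v s h => exact (PolyBounded.id.mul (h.add (.const 20))).add (.const 20)

/-- The variables `0, …, 5` hold the parameters of the problem. -/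
structure IsParameterEnv (ρ : Env) (n χ Δ K S : ℕ) : Prop where
  hn : ρ 0 = n
  hχ : ρ 1 = χ
  hΔ : ρ 2 = Δ
  hK : ρ 3 = K
  hS : ρ 4 = S
  hD : ρ 5 = Δ + 1

/-- Every program in the table language can be executed, on an input consisting of three numbers
and a square matrix with zeros on the diagonal, in time polynomial in `N = n + S + 1`. -/
theorem exists_program (s : TStmt) (e : TExpr) : ∃ (P : Program) (c : ℕ),
    ∀ (n χ Δ K S N : ℕ) (inp : ℕ → ℕ) (m : Memory), K = χ * (Δ + 1) → S = K ^ K → N = n + S + 1 →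
      0 < K → m 0 = n → m 1 = χ → m 2 = Δ → (∀ a, m (a + 3) = inp a) → inp 0 = 0 →
      inp (n + 1) = 0 → (∀ a, n * n ≤ a → inp a = 0) →
      HaltsWithin P m (c * (N + 1) ^ c) fun m' => ∃ ρ 𝕋, IsParameterEnv ρ n χ Δ K S ∧
        𝕋 0 = inp ∧ m' 0 = e.eval N (s.exec N ρ 𝕋) ρ := by
  -- The scratch space depends only on the program, so L is a constant. As the tables start at B ≥
  -- L, the stack beginning at 37 never reaches them.
  set L := 37 + s.space + e.space with hL
  have hid := PolyBounded.id
  obtain ⟨c, hc⟩ := (((((hid.mul (.const 50)).add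
    (((PolyBounded.const L).add (hid.mul (hid.add (.const 2)))).mul (.const 200))).add
    (.const 100)).add (((hid.mul (.const 20)).add (hid.mul ((hid.mul (.const 20)).add
    (.const 40)))).add (.const 100))).add s.polyBounded_time).add
    (e.polyBounded_time.add (.const 4))
  refine ⟨.seq (.relocate L) <| .seq .parameters <| .seq (s.compile 37) <|
    .seq (e.compile 37) <| .set 0 (.cell 37), c, ?_⟩
  intro n χ Δ K S N inp m hK hS hN hKpos h0 h1 h2 hm hinp0 hinp1 hinp
  have hKS : K ≤ S := hS ▸ Nat.le_self_pow hKpos.ne' K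
  have hχK : χ ≤ K := hK ▸ Nat.le_mul_of_pos_right _ (by omega)
  refine HaltsWithin.mono (T := (n * 50 + (L + n * (n + 2)) * 200 + 100) +
    ((χ * 20 + K * (K * 20 + 40) + 100) + (s.time N + (e.time N + 4)))) ?_ ?_ fun _ h => h
  · refine HaltsWithin.seq ((relocate_halts (by omega) h0 h1 h2 hm hinp0 hinp1 hinp).mono le_rfl ?_)
    rintro m₁ ⟨a0, a1, a2, a3, a4⟩
    refine HaltsWithin.seq ((parameters_halts hK hS a0 a1 a2).mono le_rfl ?_)
    rintro m₂ ⟨b4, b5, b6, b7, b8, b9, b10, b3, b⟩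
    set B := L + n * (n + 2) with hB
    have hr : Represents m₂ B N (fun v => m₂ (5 + v)) (fun i a => m₂ (B + 16 * a + i)) :=
      ⟨b3.trans a3, b4.trans hN.symm, fun _ => rfl, fun _ _ => rfl⟩
    refine HaltsWithin.seq ((s.compile_halts hr le_rfl (by omega)).mono le_rfl ?_)
    rintro m₃ ⟨hm₃, -⟩
    refine HaltsWithin.seq ((e.compile_halts hm₃ le_rfl (by omega)).mono le_rfl ?_)
    rintro m₄ ⟨hm₄, -⟩
    refine (HaltsWithin.store ?_).mono (by simp [Expr.cost]) fun _ h => h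
    refine ⟨fun v => m₂ (5 + v), fun i a => m₂ (B + 16 * a + i), ⟨b5, b6, b7, b8, b9, b10⟩, ?_, ?_⟩
    · funext a
      simp only [Fin.val_zero, add_zero]
      rw [b _ (by omega), a4]
    · simp only [Expr.eval, Function.update_self, hm₄]
  · refine le_trans ?_ (hc N)
    simp only
    have e1 : n * 50 ≤ N * 50 := by omega
    have e2 : n * (n + 2) ≤ N * (N + 2) := Nat.mul_le_mul (by omega) (by omega)
    have e3 : K * (K * 20 + 40) ≤ N * (N * 20 + 40) := Nat.mul_le_mul (by omega) (by omega)
    omega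

/-! ### Tables with three indices -/

/-- The position of the entry with indices `x`, `y`, `z` in a table of format `N × N × N`. -/
def ix (N x y z : ℕ) : ℕ := N * (N * x + y) + z

theorem ix_lt_ix {N x y z x' y' z' : ℕ} (hy' : y' < N) (hz' : z' < N) (h : x' < x) :
    ix N x' y' z' < ix N x y z := by
  have h1 : N * x' + y' + 1 ≤ N * x + y := by nlinarith
  have h2 := Nat.mul_le_mul_left N h1
  unfold ix
  rw [Nat.mul_add] at h2
  omega

theorem ix_inj {N x y z x' y' z' : ℕ} (hy : y < N) (hz : z < N) (hy' : y' < N) (hz' : z' < N)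
    (h : ix N x y z = ix N x' y' z') : x = x' ∧ y = y' ∧ z = z' := by
  have h0 : 0 < N := by omega
  unfold ix at h
  have e1 := congrArg (· / N) h
  have e2 := congrArg (· % N) h
  simp only [Nat.mul_add_div h0, Nat.mul_add_mod, Nat.div_eq_of_lt hz, Nat.div_eq_of_lt hz',
    Nat.mod_eq_of_lt hz, Nat.mod_eq_of_lt hz', add_zero] at e1 e2
  have e3 := congrArg (· / N) e1
  have e4 := congrArg (· % N) e1
  simp only [Nat.mul_add_div h0, Nat.mul_add_mod, Nat.div_eq_of_lt hy, Nat.div_eq_of_lt hy',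
    Nat.mod_eq_of_lt hy, Nat.mod_eq_of_lt hy', add_zero] at e3 e4
  exact ⟨e3, e4, e2⟩

/-- The expression for the position of an entry. -/
def TExpr.index (x y z : TExpr) : TExpr := .add (.mul .bound (.add (.mul .bound x) y)) z

/-- The entry of table `i` with indices `x`, `y`, `z`. -/
def TExpr.look (i : Fin 16) (x y z : TExpr) : TExpr := .tab i (.index x y z)

/-- Both products in `index` have `bound` as their first factor, so the cap at N has no effect. -/
theorem TExpr.eval_look {N : ℕ} {𝕋 : Tables} {ρ : Env} (i : Fin 16) (x y z : TExpr) :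
    (TExpr.look i x y z).eval N 𝕋 ρ =
      𝕋 i (ix N (x.eval N 𝕋 ρ) (y.eval N 𝕋 ρ) (z.eval N 𝕋 ρ)) := by
  simp [look, index, eval, ix]

/-- Fill table `i`, row by row, with the values of `e`, in which the variables `8`, `9`, `10` denote
the indices. -/
def TStmt.fill (i : Fin 16) (e : TExpr) : TStmt :=
  .forall_ 8 <| .forall_ 9 <| .forall_ 10 <| .write i (.index (.var 8) (.var 9) (.var 10)) e

theorem TStmt.exec_forall_induction {N : ℕ} {v : Fin 32} {s : TStmt} {ρ : Env} {𝕋 : Tables}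
    (Inv : ℕ → Tables → Prop) (h0 : Inv 0 𝕋)
    (hstep : ∀ y < N, ∀ 𝕋', Inv y 𝕋' → Inv (y + 1) (s.exec N (Function.update ρ v y) 𝕋')) :
    Inv N ((TStmt.forall_ v s).exec N ρ 𝕋) := by
  have : ∀ k ≤ N, Inv k (Nat.rec 𝕋 (fun y 𝕋' => s.exec N (Function.update ρ v y) 𝕋') k) := by
    intro k
    induction k with
    | zero => exact fun _ => h0
    | succ k ih => exact fun hk => hstep k hk _ (ih (by omega))
  exact this N le_rfl

/-- The environment with indices `x`, `y`, `z`. -/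
def indexEnv (ρ : Env) (x y z : ℕ) : Env :=
  Function.update (Function.update (Function.update ρ 8 x) 9 y) 10 z

/-- The entry with indices `x`, `y`, `z` of table `i` in `𝕋` is the value of `e` in a state that
agrees with `𝕋` on all previous tables and on all previous rows. -/
def IsFilledAt (N : ℕ) (i : Fin 16) (e : TExpr) (ρ : Env) (𝕋 : Tables) (x y z : ℕ) : Prop :=
  ∃ 𝕋' : Tables, (∀ j < i, 𝕋' j = 𝕋 j) ∧
    (∀ x' < x, ∀ y' < N, ∀ z' < N, 𝕋' i (ix N x' y' z') = 𝕋 i (ix N x' y' z')) ∧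
    𝕋 i (ix N x y z) = e.eval N 𝕋' (indexEnv ρ x y z)

/-- The state required by `IsFilledAt` is the one just before the entry is written. Each position is
written once, so the entry and the rows before it keep their values from then on. This is what makes
recursion along the first index possible. -/
theorem TStmt.fill_spec {N : ℕ} (i : Fin 16) (e : TExpr) (ρ : Env) (𝕋 : Tables) :
    (∀ j ≠ i, (TStmt.fill i e).exec N ρ 𝕋 j = 𝕋 j) ∧ ∀ x < N, ∀ y < N, ∀ z < N,
      IsFilledAt N i e ρ ((TStmt.fill i e).exec N ρ 𝕋) x y z := by
  -- W is the number of positions already written, in lexicographic order of the indices, so that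
  -- one invariant serves all three nested loops.
  let I : ℕ → Tables → Prop := fun W 𝕋₁ => (∀ j ≠ i, 𝕋₁ j = 𝕋 j) ∧
    ∀ x, ∀ y < N, ∀ z < N, ix N x y z < W → IsFilledAt N i e ρ 𝕋₁ x y z
  suffices H : I (N * (N * N)) ((TStmt.fill i e).exec N ρ 𝕋) by
    refine ⟨H.1, fun x hx y hy z hz => H.2 x y hy z hz ?_⟩
    have := ix_lt_ix (x := N) (y := 0) (z := 0) hy hz hx
    simpa [ix] using this
  refine TStmt.exec_forall_induction (fun x => I (N * (N * x))) (by simp [I]) ?_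
  intro x hx 𝕋₁ h₁
  refine TStmt.exec_forall_induction (fun y => I (N * (N * x + y))) h₁ ?_
  intro y hy 𝕋₂ h₂
  refine TStmt.exec_forall_induction (fun z => I (N * (N * x + y) + z)) h₂ ?_
  rintro z hz 𝕋₃ ⟨h₃, h₄⟩
  change I (ix N x y z + 1) _
  have hidx : (TExpr.index (.var 8) (.var 9) (.var 10)).eval N 𝕋₃ (indexEnv ρ x y z)
      = ix N x y z := by
    simp [TExpr.index, TExpr.eval, ix, indexEnv]
  set 𝕋₄ := (TStmt.write i (.index (.var 8) (.var 9) (.var 10)) e).exec N (indexEnv ρ x y z) 𝕋₃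
    with h𝕋₄
  have hexec : 𝕋₄ = Function.update 𝕋₃ i (Function.update (𝕋₃ i) (ix N x y z)
      (e.eval N 𝕋₃ (indexEnv ρ x y z))) := by
    rw [h𝕋₄]
    simp only [TStmt.exec, hidx]
  have hj : ∀ j ≠ i, 𝕋₄ j = 𝕋₃ j := fun j hj => by rw [hexec, Function.update_of_ne hj]
  have hi : ∀ a ≠ ix N x y z, 𝕋₄ i a = 𝕋₃ i a := fun a ha => by
    rw [hexec, Function.update_self, Function.update_of_ne ha]
  refine ⟨fun j hji => by rw [← h₃ j hji]; exact hj j hji, fun x' y' hy' z' hz' hlt => ?_⟩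
  by_cases heq : ix N x' y' z' = ix N x y z
  · obtain ⟨rfl, rfl, rfl⟩ := ix_inj hy' hz' hy hz heq
    refine ⟨𝕋₃, fun j hji => (hj j hji.ne).symm, fun x'' hx'' y'' hy'' z'' hz'' => ?_, ?_⟩
    · exact (hi _ (ix_lt_ix hy'' hz'' hx'').ne).symm
    · change 𝕋₄ i _ = _
      rw [hexec, Function.update_self, Function.update_self]
  · obtain ⟨𝕋', k1, k2, k3⟩ := h₄ x' y' hy' z' hz' (by
      change _ < ix N x y z; omega)
    refine ⟨𝕋', fun j hji => (k1 j hji).trans (hj j hji.ne).symm,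
      fun x'' hx'' y'' hy'' z'' hz'' => ?_, ?_⟩
    · rw [k2 x'' hx'' y'' hy'' z'' hz'']
      refine (hi _ ?_).symm
      have := ix_lt_ix (y := y') (z := z') hy'' hz'' hx''
      omega
    · rw [← k3]
      exact hi _ heq

theorem IsFilledAt.congr {N : ℕ} {i : Fin 16} {e : TExpr} {ρ : Env} {𝕋₁ 𝕋₂ : Tables} {x y z : ℕ}
    (h : IsFilledAt N i e ρ 𝕋₁ x y z) (h' : ∀ j ≤ i, 𝕋₂ j = 𝕋₁ j) :
    IsFilledAt N i e ρ 𝕋₂ x y z := by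
  obtain ⟨𝕋', h1, h2, h3⟩ := h
  refine ⟨𝕋', fun j hj => (h1 j hj).trans (h' j hj.le).symm, fun x' hx' y' hy' z' hz' => ?_, ?_⟩
  · rw [h2 x' hx' y' hy' z' hz', h' i le_rfl]
  · rw [← h3, h' i le_rfl]

/-- Fill several tables one after the other. -/
def TStmt.fillAll : List (Fin 16 × TExpr) → TStmt
  | [] => .skip
  | a :: l => .seq (.fill a.1 a.2) (fillAll l)

/-- The table numbers increase strictly along the list, so later fills do not touch the tables on
which an earlier `IsFilledAt` depends. -/
theorem TStmt.fillAll_spec {N : ℕ} {ρ : Env} {l : List (Fin 16 × TExpr)}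
    (hl : l.Pairwise fun a b => a.1 < b.1) (𝕋 : Tables) :
    (∀ j, (∀ a ∈ l, j < a.1) → (TStmt.fillAll l).exec N ρ 𝕋 j = 𝕋 j) ∧ ∀ a ∈ l, ∀ x < N, ∀ y < N,
      ∀ z < N, IsFilledAt N a.1 a.2 ρ ((TStmt.fillAll l).exec N ρ 𝕋) x y z := by
  induction l generalizing 𝕋 with
  | nil => exact ⟨fun _ _ => rfl, by simp⟩
  | cons a l ih =>
    rw [List.pairwise_cons] at hl
    obtain ⟨h1, h2⟩ := TStmt.fill_spec (N := N) a.1 a.2 ρ 𝕋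
    obtain ⟨h3, h4⟩ := ih hl.2 ((TStmt.fill a.1 a.2).exec N ρ 𝕋)
    refine ⟨fun j hj => ?_, fun b hb x hx y hy z hz => ?_⟩
    · exact (h3 j fun b hb => hj b (List.mem_cons_of_mem _ hb)).trans
        (h1 j (hj a List.mem_cons_self).ne)
    · rcases List.mem_cons.mp hb with rfl | hb
      · exact (h2 x hx y hy z hz).congr fun j hj => h3 j fun c hc => hj.trans_lt (hl.1 c hc)
      · exact h4 b hb x hx y hy z hz

/-! ### Logic in the table language -/

namespace TExpr

variable {N : ℕ} {𝕋 : Tables} {ρ : Env}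

/-- An expression holds if its value is not zero. -/
def Holds (N : ℕ) (𝕋 : Tables) (ρ : Env) (e : TExpr) : Prop := e.eval N 𝕋 ρ ≠ 0

/-- `a < b` -/
def lt (a b : TExpr) : TExpr := .sub b a

/-- Negation. -/
def not (a : TExpr) : TExpr := .ite a (.const 0) (.const 1)

/-- `a = b` -/
def eq (a b : TExpr) : TExpr := .not (.add (.sub a b) (.sub b a))

/-- Conjunction. -/
def and (a b : TExpr) : TExpr := .ite a b (.const 0)

/-- Disjunction. -/
def or (a b : TExpr) : TExpr := .add a b

/-- Implication. -/
def imp (a b : TExpr) : TExpr := .or (.not a) b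

/-- Existence below `N`. -/
def ex (v : Fin 32) (e : TExpr) : TExpr := .sum v e

/-- Universal quantification below `N`. -/
def all (v : Fin 32) (e : TExpr) : TExpr := .not (.sum v (.not e))

/-- The number of values of `v` below `N` for which `e` holds. -/
def count (v : Fin 32) (e : TExpr) : TExpr := .sum v (.ite e (.const 1) (.const 0))

/-- The least value of `v` for which `e` holds; the auxiliary variable `w` must not occur
in `e`. -/
def least (v w : Fin 32) (e : TExpr) : TExpr :=
  .count w (.all v (.imp e (.lt (.var w) (.var v))))

theorem holds_lt {a b : TExpr} :
    Holds N 𝕋 ρ (lt a b) ↔ a.eval N 𝕋 ρ < b.eval N 𝕋 ρ := by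
  simp [Holds, lt, eval]; omega

theorem holds_not {a : TExpr} : Holds N 𝕋 ρ (not a) ↔ ¬ Holds N 𝕋 ρ a := by
  simp only [Holds, not, eval]; split_ifs <;> simp_all

theorem holds_eq {a b : TExpr} :
    Holds N 𝕋 ρ (eq a b) ↔ a.eval N 𝕋 ρ = b.eval N 𝕋 ρ := by
  rw [eq, holds_not]; simp [Holds, eval]; omega

theorem holds_and {a b : TExpr} :
    Holds N 𝕋 ρ (and a b) ↔ Holds N 𝕋 ρ a ∧ Holds N 𝕋 ρ b := by
  simp only [Holds, and, eval]; split_ifs <;> simp_all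

theorem holds_or {a b : TExpr} :
    Holds N 𝕋 ρ (or a b) ↔ Holds N 𝕋 ρ a ∨ Holds N 𝕋 ρ b := by
  simp only [Holds, or, eval]; omega

theorem holds_imp {a b : TExpr} :
    Holds N 𝕋 ρ (imp a b) ↔ (Holds N 𝕋 ρ a → Holds N 𝕋 ρ b) := by
  rw [imp, holds_or, holds_not]; tauto

theorem holds_ex {v : Fin 32} {e : TExpr} :
    Holds N 𝕋 ρ (ex v e) ↔ ∃ y < N, Holds N 𝕋 (Function.update ρ v y) e := by
  simp [Holds, ex, eval]

theorem holds_all {v : Fin 32} {e : TExpr} :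
    Holds N 𝕋 ρ (all v e) ↔ ∀ y < N, Holds N 𝕋 (Function.update ρ v y) e := by
  have : Holds N 𝕋 ρ (all v e) ↔ ¬ Holds N 𝕋 ρ (ex v (not e)) := holds_not
  rw [this, holds_ex]
  simp [holds_not]

theorem holds_ite {a b c : TExpr} : Holds N 𝕋 ρ (ite a b c) ↔
    (Holds N 𝕋 ρ a ∧ Holds N 𝕋 ρ b) ∨ (¬ Holds N 𝕋 ρ a ∧ Holds N 𝕋 ρ c) := by
  simp only [Holds, eval]; split_ifs <;> simp_all

theorem holds_iff {a : TExpr} : a.eval N 𝕋 ρ ≠ 0 ↔ Holds N 𝕋 ρ a := Iff.rfl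

open Classical in
theorem eval_ite {a b c : TExpr} : (ite a b c).eval N 𝕋 ρ =
    if Holds N 𝕋 ρ a then b.eval N 𝕋 ρ else c.eval N 𝕋 ρ := by
  simp only [eval, Holds]; congr

open Classical in
theorem eval_count {v : Fin 32} {e : TExpr} : (count v e).eval N 𝕋 ρ =
    ((Finset.range N).filter fun y => Holds N 𝕋 (Function.update ρ v y) e).card := by
  rw [Finset.card_filter]
  simp only [count, eval, Holds]
  exact Finset.sum_congr rfl fun y _ => by congr

/-- `least` computes the least witness. -/
theorem eval_least {v w : Fin 32} {e : TExpr} {p : ℕ → Prop} (hvw : v ≠ w)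
    (hp : ∀ q y, Holds N 𝕋 (Function.update (Function.update ρ w q) v y) e ↔ p y)
    (hex : ∃ y < N, p y) :
    (least v w e).eval N 𝕋 ρ < N ∧ p ((least v w e).eval N 𝕋 ρ) ∧
      ∀ y < (least v w e).eval N 𝕋 ρ, ¬ p y := by
  classical
  have hex' : ∃ y, p y := hex.imp fun y h => h.2
  have hlt : Nat.find hex' < N := by
    obtain ⟨y, hy, h⟩ := hex
    exact (Nat.find_min' hex' h).trans_lt hy
  -- The numbers q that are smaller than every witness are those below the least witness, so
  -- counting them yields that witness.
  have key : (least v w e).eval N 𝕋 ρ = Nat.find hex' := by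
    rw [least, eval_count, ← Finset.card_range (Nat.find hex')]
    congr 1
    ext q
    simp only [Finset.mem_filter, Finset.mem_range, holds_all, holds_imp, holds_lt, hp, eval,
      Function.update_self, Function.update_of_ne hvw.symm]
    constructor
    · rintro ⟨-, h⟩
      exact h _ hlt (Nat.find_spec hex')
    · intro h
      exact ⟨h.trans hlt, fun y _ hy => h.trans_le (Nat.find_min' hex' hy)⟩
  rw [key]
  exact ⟨hlt, Nat.find_spec hex', fun y hy => Nat.find_min hex' hy⟩

end TExpr

end RAM

/-! ### Chordal graphs and Dirac's theorem -/

namespace SimpleGraph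

theorem cycleGraph_adj_of_lt {n : ℕ} {u v : Fin n} (h : u < v) :
    (cycleGraph n).Adj u v ↔ (v : ℕ) = u + 1 ∨ ((u : ℕ) = 0 ∧ (v : ℕ) + 1 = n) := by
  have hv := v.isLt
  have h' : (u : ℕ) < v := h
  rw [cycleGraph_adj', Fin.coe_sub_iff_lt.mpr h, Fin.sub_val_of_le h.le]
  omega

variable {V : Type*} {G : SimpleGraph V}

/-- In a chordal graph there are no two nonadjacent vertices `x` and `y` with a common neighbor `r`
and a path from `x` to `y` whose inner vertices are different from `r` and not adjacent to `r`. -/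
theorem IsChordalGraph.false_of_detour (hG : G.IsChordalGraph) {r : V} {L : ℕ} {f : ℕ → V}
    (hxy : f 0 ≠ f L) (hadj : ¬ G.Adj (f 0) (f L)) (hx : G.Adj r (f 0)) (hy : G.Adj r (f L))
    (hf : ∀ i < L, G.Adj (f i) (f (i + 1)))
    (hr : ∀ i, 0 < i → i < L → ¬ G.Adj r (f i) ∧ f i ≠ r) : False := by
  classical
  induction L using Nat.strong_induction_on generalizing f with
  | _ L ih =>
    -- Deleting the d vertices after `f i` would give a shorter detour, which is impossible by
    -- induction. This rules out repetitions as well as chords, so the path is induced.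
    have shorten : ∀ i d, 0 < d → i + d ≤ L → (i + d < L → G.Adj (f i) (f (i + 1 + d))) →
        (i + d = L → f i = f L) → False := by
      intro i d hd hid hstep hend
      set g : ℕ → V := fun k => if k ≤ i then f k else f (k + d) with hg
      have g0 : g 0 = f 0 := by simp [hg]
      have gL : g (L - d) = f L := by
        simp only [hg]
        split_ifs with h
        · rw [show L - d = i by omega]; exact hend (by omega)
        · rw [show L - d + d = L by omega]
      refine ih (L - d) (by omega) (f := g) (by rwa [g0, gL]) (by rwa [g0, gL]) (by rwa [g0])
        (by rwa [gL]) (fun k hk => ?_) fun k hk hk' => ?_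
      · simp only [hg]
        by_cases h1 : k + 1 ≤ i
        · rw [if_pos (by omega), if_pos h1]; exact hf k (by omega)
        · rw [if_neg h1]
          by_cases h2 : k ≤ i
          · rw [if_pos h2, show k = i by omega]; exact hstep (by omega)
          · rw [if_neg h2, show k + 1 + d = k + d + 1 by ring]; exact hf _ (by omega)
      · simp only [hg]
        split_ifs
        · exact hr k hk (by omega)
        · exact hr _ (by omega) (by omega)
    have hinj : ∀ i j, i < j → j ≤ L → f i ≠ f j := by
      intro i j hij hj heq
      refine shorten i (j - i) (by omega) (by omega) (fun h => ?_) fun h => ?_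
      · rw [heq, show i + 1 + (j - i) = j + 1 by omega]; exact hf j (by omega)
      · rw [heq, show j = L by omega]
    have hchord : ∀ i j, i < j → j ≤ L → (G.Adj (f i) (f j) ↔ j = i + 1) := by
      intro i j hij hj
      refine ⟨fun h => ?_, ?_⟩
      · by_contra hne
        refine shorten i (j - i - 1) (by omega) (by omega) (fun _ => ?_) (by omega)
        rwa [show i + 1 + (j - i - 1) = j by omega]
      · rintro rfl
        exact hf i (by omega)
    have hL : 2 ≤ L := by
      rcases L with _ | _ | L
      · exact absurd rfl hxy
      · exact absurd (hf 0 (by omega)) hadj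
      · omega
    have hne : ∀ i ≤ L, f i ≠ r := by
      intro i hi
      rcases Nat.eq_zero_or_pos i with rfl | h0
      · exact hx.ne'
      · rcases hi.eq_or_lt with rfl | h1
        · exact hy.ne'
        · exact (hr i h0 h1).2
    have hrad : ∀ i ≤ L, (G.Adj (f i) r ↔ i = 0 ∨ i = L) := by
      intro i hi
      rw [G.adj_comm]
      refine ⟨fun h => ?_, ?_⟩
      · by_contra hc
        exact (hr i (by omega) (by omega)).1 h
      · rintro (rfl | rfl)
        · exact hx
        · exact hy
    -- Putting r after `f L` closes the path to an induced cycle of length L + 2, which is at least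
    -- four because the ends are distinct and not adjacent.
    set φ : Fin (L + 2) → V := fun i => if (i : ℕ) ≤ L then f i else r with hφ
    have key : ∀ i j : Fin (L + 2), i < j →
        φ i ≠ φ j ∧ (G.Adj (φ i) (φ j) ↔ (cycleGraph (L + 2)).Adj i j) := by
      intro i j hij
      have hij' : (i : ℕ) < j := hij
      have hj := j.isLt
      rw [cycleGraph_adj_of_lt hij]
      simp only [hφ]
      rw [if_pos (by omega : (i : ℕ) ≤ L)]
      split_ifs with h
      · refine ⟨hinj i j hij' h, ?_⟩
        rw [hchord i j hij' h]
        omega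
      · refine ⟨hne i (by omega), ?_⟩
        rw [hrad i (by omega)]
        omega
    have hφinj : Function.Injective φ := by
      intro i j h
      rcases lt_trichotomy i j with h' | h' | h'
      · exact absurd h (key i j h').1
      · exact h'
      · exact absurd h.symm (key j i h').1
    refine hG (L + 2) (by omega) ⟨⟨⟨φ, hφinj⟩, ?_⟩⟩
    intro i j
    simp only [Function.Embedding.coeFn_mk]
    rcases lt_trichotomy i j with h' | h' | h'
    · exact (key i j h').2
    · subst h'; simp
    · rw [G.adj_comm, (cycleGraph (L + 2)).adj_comm]
      exact (key j i h').2

theorem _root_.Relation.ReflTransGen.exists_chain {α : Type*} {r : α → α → Prop} {x y : α}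
    (h : Relation.ReflTransGen r x y) :
    ∃ (L : ℕ) (f : ℕ → α), f 0 = x ∧ f L = y ∧ ∀ i < L, r (f i) (f (i + 1)) := by
  induction h with
  | refl => exact ⟨0, fun _ => x, rfl, rfl, by simp⟩
  | @tail y z _ hyz ih =>
    obtain ⟨L, f, h0, hL, hf⟩ := ih
    refine ⟨L + 1, fun i => if i ≤ L then f i else z, by simp [h0], by simp, fun i hi => ?_⟩
    by_cases h : i + 1 ≤ L
    · simp only [if_pos h, if_pos (by omega : i ≤ L)]
      exact hf i (by omega)
    · simp only [if_neg h, if_pos (by omega : i ≤ L)]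
      rwa [show i = L by omega, hL]

/-- Dirac's theorem: every nonempty set of vertices of a chordal graph contains a vertex that is
simplicial in the subgraph induced by the set. -/
theorem IsChordalGraph.exists_simplicial (hG : G.IsChordalGraph) (R : Finset V)
    (hR : R.Nonempty) : ∃ v ∈ R, ∀ a ∈ R, ∀ b ∈ R, G.Adj v a → G.Adj v b → a ≠ b → G.Adj a b := by
  classical
  induction R using Finset.strongInduction with
  | _ R ih =>
    by_cases hcl : ∀ a ∈ R, ∀ b ∈ R, a ≠ b → G.Adj a b
    · obtain ⟨v, hv⟩ := hR
      exact ⟨v, hv, fun a ha b hb _ _ hab => hcl a ha b hb hab⟩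
    push Not at hcl
    obtain ⟨a₀, ha₀, b₀, hb₀, hne₀, hadj₀⟩ := hcl
    let link : Finset V → V → V → Prop := fun A u v => u ∈ A ∧ v ∈ A ∧ G.Adj u v
    let rest : Finset V → Finset V := fun A => R.filter fun u => u ∉ A ∧ ∀ a ∈ A, ¬ G.Adj a u
    let good : Finset (Finset V) := R.powerset.filter fun A => A.Nonempty ∧ (rest A).Nonempty ∧
      ∀ x ∈ A, ∀ y ∈ A, Relation.ReflTransGen (link A) x y
    have hgood : good.Nonempty := by
      refine ⟨{a₀}, ?_⟩
      simp only [good, Finset.mem_filter, Finset.mem_powerset, Finset.singleton_subset_iff]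
      refine ⟨ha₀, ⟨a₀, by simp⟩, ⟨b₀, ?_⟩, ?_⟩
      · simp [rest, hb₀, hne₀.symm, hadj₀]
      · intro x hx y hy
        rw [Finset.mem_singleton.mp hx, Finset.mem_singleton.mp hy]
    -- A is a largest connected subset of R such that some vertex of R is neither in A nor adjacent
    -- to it. With this choice the induction does not need a second, nonadjacent simplicial vertex.
    obtain ⟨A, hA, hmax⟩ := Finset.exists_max_image good Finset.card hgood
    simp only [good, Finset.mem_filter, Finset.mem_powerset] at hA hmax
    obtain ⟨hAR, ⟨a₁, ha₁⟩, hrest, hconn⟩ := hA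
    -- Otherwise s could be added to A: the set stays connected, and u is still outside it and not
    -- adjacent to it.
    have hcomplete : ∀ s ∈ R, s ∉ A → ∀ a ∈ A, G.Adj a s → ∀ u ∈ rest A, G.Adj s u := by
      intro s hs hsA a ha has u hu
      by_contra hsu
      simp only [rest, Finset.mem_filter] at hu
      have hlink : ∀ x y, Relation.ReflTransGen (link A) x y →
          Relation.ReflTransGen (link (insert s A)) x y := fun x y h =>
        Relation.ReflTransGen.mono (fun u v h =>
          ⟨Finset.mem_insert_of_mem h.1, Finset.mem_insert_of_mem h.2.1, h.2.2⟩) x y h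
      have hs_a : link (insert s A) s a :=
        ⟨Finset.mem_insert_self _ _, Finset.mem_insert_of_mem ha, has.symm⟩
      have ha_s : link (insert s A) a s := ⟨hs_a.2.1, hs_a.1, has⟩
      have := hmax (insert s A) ⟨Finset.insert_subset hs hAR, ⟨s, by simp⟩, ⟨u, ?_⟩, ?_⟩
      · rw [Finset.card_insert_of_notMem hsA] at this
        omega
      · simp only [rest, Finset.mem_filter, Finset.mem_insert, not_or]
        refine ⟨hu.1, ⟨?_, hu.2.1⟩, ?_⟩
        · rintro rfl
          exact hu.2.2 a ha has
        · rintro b (rfl | hb)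
          · exact hsu
          · exact hu.2.2 b hb
      · intro x hx y hy
        rcases Finset.mem_insert.mp hx with rfl | hx' <;>
          rcases Finset.mem_insert.mp hy with rfl | hy'
        · exact .refl
        · exact .head hs_a (hlink _ _ (hconn a ha y hy'))
        · exact .tail (hlink _ _ (hconn x hx' a ha)) ha_s
        · exact hlink _ _ (hconn x hx' y hy')
    -- Two nonadjacent boundary vertices of A would have a common neighbor u in `rest A` and be
    -- joined by a path through A, which contains neither u nor a neighbor of u: a detour.
    have hclique : ∀ s ∈ R, s ∉ A → ∀ a ∈ A, G.Adj a s → ∀ s' ∈ R, s' ∉ A → ∀ a' ∈ A,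
        G.Adj a' s' → s ≠ s' → G.Adj s s' := by
      intro s hs hsA a ha has s' hs' hsA' a' ha' has' hne
      by_contra hadj
      obtain ⟨u, hu⟩ := hrest
      have h1 := hcomplete s hs hsA a ha has u hu
      have h2 := hcomplete s' hs' hsA' a' ha' has' u hu
      simp only [rest, Finset.mem_filter] at hu
      obtain ⟨L, f, h0, hL, hf⟩ := (hconn a ha a' ha').exists_chain
      have hfA : ∀ i ≤ L, f i ∈ A := by
        intro i hi
        rcases hi.eq_or_lt with rfl | hi
        · rwa [hL]
        · exact (hf i hi).1
      set g : ℕ → V := fun k => if k = 0 then s else if k ≤ L + 1 then f (k - 1) else s' with hg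
      have g0 : g 0 = s := by simp [hg]
      have gL : g (L + 2) = s' := by simp [hg]
      have gmid : ∀ i ≤ L, g (i + 1) = f i := fun i hi => by simp [hg, hi]
      refine hG.false_of_detour (r := u) (L := L + 2) (f := g) (by rwa [g0, gL])
        (by rwa [g0, gL]) (by rw [g0]; exact h1.symm) (by rw [gL]; exact h2.symm) ?_ ?_
      · intro i hi
        rcases i with _ | i
        · rw [g0, gmid 0 (by omega), h0]
          exact has.symm
        · rw [gmid i (by omega)]
          by_cases h : i = L
          · rw [h, gL, hL]
            exact has'
          · rw [gmid (i + 1) (by omega)]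
            exact (hf i (by omega)).2.2
      · intro i hi hi'
        obtain ⟨i, rfl⟩ : ∃ k, i = k + 1 := ⟨i - 1, by omega⟩
        rw [gmid i (by omega)]
        have hi := hfA i (by omega)
        refine ⟨fun h => hu.2.2 _ hi h.symm, ?_⟩
        intro h
        rw [h] at hi
        exact hu.2.1 hi
    have hss : rest A ⊂ R := by
      refine Finset.filter_ssubset.mpr ⟨a₁, hAR ha₁, ?_⟩
      simp [ha₁]
    obtain ⟨v, hv, hsimp⟩ := ih (rest A) hss hrest
    have hv' := hv
    simp only [rest, Finset.mem_filter] at hv'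
    -- A neighbor of v lies in `rest A` or in the boundary of A. The boundary is a clique and
    -- complete to `rest A`, so v, simplicial in `rest A`, is simplicial in R.
    have hcase : ∀ a ∈ R, G.Adj v a → a ∈ rest A ∨ (a ∉ A ∧ ∃ b ∈ A, G.Adj b a) := by
      intro a ha hva
      have haA : a ∉ A := fun h => hv'.2.2 a h hva.symm
      by_cases h : ∃ b ∈ A, G.Adj b a
      · exact .inr ⟨haA, h⟩
      · push Not at h
        exact .inl (Finset.mem_filter.mpr ⟨ha, haA, h⟩)
    refine ⟨v, hv'.1, fun a ha b hb hva hvb hab => ?_⟩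
    rcases hcase a ha hva with h1 | ⟨h1, a', ha', haa'⟩ <;>
      rcases hcase b hb hvb with h2 | ⟨h2, b', hb', hbb'⟩
    · exact hsimp a h1 b h2 hva hvb hab
    · exact (hcomplete b hb h2 b' hb' hbb' a h1).symm
    · exact hcomplete a ha h1 a' ha' haa' b h2
    · exact hclique a ha h1 a' ha' haa' b hb h2 b' hb' hbb' hab

end SimpleGraph

/-! ### The dynamic program and its correctness, independently of the machine -/

namespace DefectiveColoring

/-- `u` is a neighbor of `v` that comes after `v`. -/
def Later (n : ℕ) (AD : ℕ → ℕ → Prop) (v u : ℕ) : Prop := v < u ∧ u < n ∧ AD v u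

/-- The bag of `w` consists of `w` and its later neighbors. -/
def Bag (n : ℕ) (AD : ℕ → ℕ → Prop) (w u : ℕ) : Prop := u = w ∨ Later n AD w u

open Classical in
/-- Merging the state `σ` of a vertex `v`, which is eliminated, into the state `τ` of its parent `p`
gives the state `s`. -/
def Merges (n Δ : ℕ) (AD : ℕ → ℕ → Prop) (c k : ℕ → ℕ → ℕ) (v p σ τ s : ℕ) : Prop :=
  k σ v + ((Finset.range n).filter fun u => Later n AD v u ∧ c σ u = c σ v).card ≤ Δ ∧
    ∀ u, Bag n AD p u → c s u = c τ u ∧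
      (Later n AD v u → c τ u = c σ u ∧
        k s u = k τ u + k σ u + if c σ u = c σ v then 1 else 0) ∧
      (¬ Later n AD v u → k s u = k τ u)

/-- The data of the dynamic program.  The vertices `0, …, n - 1` are numbered in a perfect
elimination order, states are numbers below `S`, and a state `s` assigns to a vertex `u` the
color `c s u` and the number `k s u` of eliminated neighbors of the same color.  The states of `w`
that are possible when the vertices before `t` are eliminated are those satisfying `A t w`. -/
structure DynamicProgram (n χ Δ S : ℕ) (AD : ℕ → ℕ → Prop) (c k : ℕ → ℕ → ℕ) (par : ℕ → ℕ)
    (A : ℕ → ℕ → ℕ → Prop) : Prop where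
  symm : ∀ u < n, ∀ v < n, AD u v → AD v u
  irrefl : ∀ u < n, ¬ AD u u
  peo : ∀ i j l, Later n AD i j → Later n AD i l → j ≠ l → AD j l
  par_spec : ∀ v < n, (par v = n ∧ ∀ u, ¬ Later n AD v u) ∨
    (Later n AD v (par v) ∧ ∀ u, Later n AD v u → par v ≤ u)
  state_le : ∀ s < S, ∀ u < n, c s u < χ ∧ k s u ≤ Δ
  exists_state : ∀ w < n, ∀ f g : ℕ → ℕ, (∀ u, Bag n AD w u → f u < χ ∧ g u ≤ Δ) →
    ∃ s < S, ∀ u, Bag n AD w u → c s u = f u ∧ k s u = g u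
  zero : ∀ w < n, ∀ s < S, A 0 w s ↔ ∀ u, Bag n AD w u → k s u = 0
  succ_par : ∀ t < n, ∀ w < n, ∀ s < S, w = par t →
    (A (t + 1) w s ↔ ∃ σ < S, ∃ τ < S, A t t σ ∧ A t w τ ∧ Merges n Δ AD c k t w σ τ s)
  succ_ne : ∀ t < n, ∀ w < n, ∀ s < S, w ≠ par t → (A (t + 1) w s ↔ A t w s)

namespace DynamicProgram

open Classical in
/-- The number of neighbors of `u` with the same color, where `C` is the coloring of the vertices
from `t` on, which have states `ρ`. -/
noncomputable def load (n : ℕ) (AD : ℕ → ℕ → Prop) (k : ℕ → ℕ → ℕ) (t : ℕ) (C ρ : ℕ → ℕ) (u : ℕ) :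
    ℕ :=
  ∑ w ∈ Finset.Ico t n, ((if AD u w ∧ C w = C u then 1 else 0) +
    if Bag n AD w u then k (ρ w) u else 0)

/-- The coloring `C` and the states `ρ` describe a partial solution on the vertices from
`t` on. -/
structure IsPartial (n Δ S : ℕ) (AD : ℕ → ℕ → Prop) (c k : ℕ → ℕ → ℕ)
    (A : ℕ → ℕ → ℕ → Prop) (t : ℕ) (C ρ : ℕ → ℕ) : Prop where
  lt : ∀ w, t ≤ w → w < n → ρ w < S
  mem : ∀ w, t ≤ w → w < n → A t w (ρ w)
  color : ∀ w, t ≤ w → w < n → ∀ u, Bag n AD w u → c (ρ w) u = C u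
  load_le : ∀ u, t ≤ u → u < n → load n AD k t C ρ u ≤ Δ

variable {n χ Δ S : ℕ} {AD : ℕ → ℕ → Prop} {c k : ℕ → ℕ → ℕ} {par : ℕ → ℕ}
  {A : ℕ → ℕ → ℕ → Prop}

theorem load_congr {t : ℕ} {C C' ρ ρ' : ℕ → ℕ} {u : ℕ} (hu : C u = C' u)
    (hC : ∀ w, t ≤ w → w < n → C w = C' w) (hρ : ∀ w, t ≤ w → w < n → ρ w = ρ' w) :
    load n AD k t C ρ u = load n AD k t C' ρ' u := by
  refine Finset.sum_congr rfl fun w hw => ?_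
  rw [Finset.mem_Ico] at hw
  rw [hu, hC w hw.1 hw.2, hρ w hw.1 hw.2]

open Classical in
theorem load_eq_add {t : ℕ} (ht : t < n) {C ρ : ℕ → ℕ} {u : ℕ} :
    load n AD k t C ρ u = ((if AD u t ∧ C t = C u then 1 else 0) +
      if Bag n AD t u then k (ρ t) u else 0) + load n AD k (t + 1) C ρ u :=
  Finset.sum_eq_sum_Ico_succ_bot ht _

theorem bag_of_le {t w u : ℕ} (htw : t < w) (hb : Bag n AD w u) : t < u := by
  rcases hb with rfl | hb
  · exact htw
  · exact htw.trans hb.1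

theorem bag_lt {w u : ℕ} (hw : w < n) (hb : Bag n AD w u) : u < n := by
  rcases hb with rfl | hb
  · exact hw
  · exact hb.2.1

variable (h : DynamicProgram n χ Δ S AD c k par A)
include h

theorem adj_iff_later {t u : ℕ} (htu : t < u) (hu : u < n) : AD u t ↔ Later n AD t u :=
  ⟨fun hu' => ⟨htu, hu, h.symm u hu t (htu.trans hu) hu'⟩,
    fun hl => h.symm t (htu.trans hu) u hu hl.2.2⟩

open Classical in
-- t is the first remaining vertex: its own bag is the only remaining one that contains it, and its
-- remaining neighbors are all later.
theorem load_self {t : ℕ} (ht : t < n) {C ρ : ℕ → ℕ} :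
    load n AD k t C ρ t = k (ρ t) t +
      ((Finset.range n).filter fun u => Later n AD t u ∧ C u = C t).card := by
  unfold load
  rw [Finset.sum_add_distrib, add_comm]
  congr 1
  · rw [Finset.sum_eq_single t]
    · exact if_pos (Or.inl rfl)
    · intro w hw hwt
      rw [Finset.mem_Ico] at hw
      refine if_neg ?_
      rintro (rfl | h')
      · exact hwt rfl
      · exact absurd h'.1 (by omega)
    · intro h'
      exact absurd (Finset.mem_Ico.mpr ⟨le_rfl, ht⟩) h'
  · rw [← Finset.card_filter]
    congr 1
    ext w
    simp only [Finset.mem_filter, Finset.mem_Ico, Finset.mem_range]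
    constructor
    · rintro ⟨⟨h1, h2⟩, h3, h4⟩
      refine ⟨h2, ⟨lt_of_le_of_ne h1 ?_, h2, h3⟩, h4⟩
      rintro rfl
      exact h.irrefl _ h2 h3
    · rintro ⟨h1, h2, h3⟩
      exact ⟨⟨h2.1.le, h1⟩, h2.2.2, h3⟩

/-- The later neighbors of t form a clique and the parent is the first of them, so the others are
later neighbors of the parent. Thus everything known about them can be stored there. -/
theorem later_bag_par {t u : ℕ} (ht : t < n) (hl : Later n AD t u) :
    Later n AD t (par t) ∧ Bag n AD (par t) u := by
  rcases h.par_spec t ht with ⟨-, h2⟩ | ⟨h1, h2⟩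
  · exact absurd hl (h2 u)
  · refine ⟨h1, ?_⟩
    by_cases he : u = par t
    · exact .inl he
    · exact .inr ⟨lt_of_le_of_ne (h2 u hl) (Ne.symm he), hl.2.1, h.peo _ _ _ h1 hl (Ne.symm he)⟩

open Classical in
/-- Merging the state of an eliminated vertex into the state of its parent does not change the
loads. -/
theorem load_merge {t : ℕ} (ht : t < n) (hp : Later n AD t (par t)) {C ρ : ℕ → ℕ} {s : ℕ}
    (hs : ∀ u, Bag n AD (par t) u → k s u = k (ρ (par t)) u +
      if Later n AD t u then k (ρ t) u + (if C u = C t then 1 else 0) else 0) {u : ℕ}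
    (htu : t < u) (hu : u < n) :
    load n AD k (t + 1) C (Function.update ρ (par t) s) u = load n AD k t C ρ u := by
  -- Among the vertices after t only the summand of the parent changes; it gains exactly what the
  -- summand of t contributed.
  have h1 : load n AD k (t + 1) C (Function.update ρ (par t) s) u =
      load n AD k (t + 1) C ρ u + if Bag n AD (par t) u then
        (if Later n AD t u then k (ρ t) u + (if C u = C t then 1 else 0) else 0) else 0 := by
    unfold load
    have : ∀ w ∈ Finset.Ico (t + 1) n, ((if AD u w ∧ C w = C u then 1 else 0) +
        if Bag n AD w u then k (Function.update ρ (par t) s w) u else 0) =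
        ((if AD u w ∧ C w = C u then 1 else 0) + if Bag n AD w u then k (ρ w) u else 0) +
        if w = par t then (if Bag n AD (par t) u then
        (if Later n AD t u then k (ρ t) u + (if C u = C t then 1 else 0) else 0) else 0)
        else 0 := by
      intro w hw
      by_cases hwp : w = par t
      · subst hwp
        rw [Function.update_self, if_pos rfl]
        by_cases hb : Bag n AD (par t) u
        · rw [if_pos hb, if_pos hb, if_pos hb, hs u hb]; ring
        · rw [if_neg hb, if_neg hb, if_neg hb]
      · rw [Function.update_of_ne hwp, if_neg hwp, add_zero]
    rw [Finset.sum_congr rfl this, Finset.sum_add_distrib, Finset.sum_ite_eq',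
      if_pos (Finset.mem_Ico.mpr ⟨hp.1, hp.2.1⟩)]
  rw [h1, load_eq_add ht, h.adj_iff_later htu hu, add_comm]
  congr 1
  by_cases hl : Later n AD t u
  · have hb : Bag n AD t u := .inr hl
    simp only [hl, hb, (h.later_bag_par ht hl).2, true_and, if_true, @eq_comm _ (C t) (C u)]
    ring
  · have hb : ¬ Bag n AD t u := by
      rintro (rfl | hb)
      · exact lt_irrefl _ htu
      · exact hl hb
    simp [hl, hb]

theorem load_root {t : ℕ} (ht : t < n) (hroot : ∀ u, ¬ Later n AD t u) {C ρ : ℕ → ℕ} {u : ℕ}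
    (htu : t < u) (hu : u < n) : load n AD k t C ρ u = load n AD k (t + 1) C ρ u := by
  have hb : ¬ Bag n AD t u := by
    rintro (rfl | hb)
    · exact lt_irrefl _ htu
    · exact hroot _ hb
  rw [load_eq_add ht, h.adj_iff_later htu hu]
  simp [hroot u, hb]

/-- The counts in the new state of the parent are parts of loads, hence at most Δ, so `exists_state`
supplies a state with these counts. The second conclusion is what is needed at the roots. -/
theorem IsPartial.eliminate {t : ℕ} (ht : t < n) {C ρ : ℕ → ℕ}
    (hP : IsPartial n Δ S AD c k A t C ρ) :
    (∃ ρ', IsPartial n Δ S AD c k A (t + 1) C ρ') ∧ ∃ σ < S, A t t σ := by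
  classical
  refine ⟨?_, ρ t, hP.lt t le_rfl ht, hP.mem t le_rfl ht⟩
  rcases h.par_spec t ht with ⟨hpar, hroot⟩ | ⟨hp, -⟩
  · refine ⟨ρ, fun w hw hw' => hP.lt w (by omega) hw', fun w hw hw' => ?_,
      fun w hw hw' => hP.color w (by omega) hw', fun u hu hu' => ?_⟩
    · exact (h.succ_ne t ht w hw' _ (hP.lt w (by omega) hw') (by omega)).mpr
        (hP.mem w (by omega) hw')
    · rw [← h.load_root ht hroot (by omega) hu']
      exact hP.load_le u (by omega) hu'
  · set p := par t with hpdef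
    have hcp := hP.color p hp.1.le hp.2.1
    have hct := hP.color t le_rfl ht
    have hadd : ∀ u, Bag n AD p u → k (ρ p) u +
        (if Later n AD t u then k (ρ t) u + (if C u = C t then 1 else 0) else 0) ≤ Δ := by
      intro u hu
      have htu := bag_of_le hp.1 hu
      have hun := bag_lt hp.2.1 hu
      refine le_trans ?_ (hP.load_le u htu.le hun)
      rw [load_eq_add ht, h.adj_iff_later htu hun, add_comm]
      refine add_le_add ?_ ?_
      · by_cases hl : Later n AD t u
        · have hb : Bag n AD t u := .inr hl
          simp only [hl, hb, true_and, if_true, @eq_comm _ (C t) (C u)]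
          omega
        · simp [hl]
      · unfold load
        refine le_trans ?_ (Finset.single_le_sum (fun _ _ => Nat.zero_le _)
          (Finset.mem_Ico.mpr ⟨hp.1, hp.2.1⟩))
        rw [if_pos hu]
        omega
    obtain ⟨s, hs, hsu⟩ := h.exists_state p hp.2.1 C _ (fun u hu =>
      ⟨hcp u hu ▸ (h.state_le _ (hP.lt p hp.1.le hp.2.1) u (bag_lt hp.2.1 hu)).1, hadd u hu⟩)
    refine ⟨Function.update ρ p s, fun w hw hw' => ?_, fun w hw hw' => ?_,
      fun w hw hw' u hu => ?_, fun u hu hu' => ?_⟩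
    · by_cases hwp : w = p
      · rw [hwp, Function.update_self]; exact hs
      · rw [Function.update_of_ne hwp]; exact hP.lt w (by omega) hw'
    · by_cases hwp : w = p
      · rw [hwp, Function.update_self, h.succ_par t ht p hp.2.1 s hs rfl]
        refine ⟨ρ t, hP.lt t le_rfl ht, ρ p, hP.lt p hp.1.le hp.2.1, hP.mem t le_rfl ht,
          hP.mem p hp.1.le hp.2.1, ?_, fun u hu => ⟨?_, fun hl => ⟨?_, ?_⟩, fun hl => ?_⟩⟩
        · have := hP.load_le t le_rfl ht
          rw [h.load_self ht] at this
          convert this using 3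
          refine Finset.filter_congr fun u _ => and_congr_right fun hl => ?_
          rw [hct u (.inr hl), hct t (.inl rfl)]
        · rw [(hsu u hu).1, hcp u hu]
        · rw [hcp u hu, hct u (.inr hl)]
        · rw [(hsu u hu).2, if_pos hl, hct u (.inr hl), hct t (.inl rfl), add_assoc]
        · rw [(hsu u hu).2, if_neg hl, add_zero]
      · rw [Function.update_of_ne hwp]
        exact (h.succ_ne t ht w hw' _ (hP.lt w (by omega) hw') hwp).mpr
          (hP.mem w (by omega) hw')
    · by_cases hwp : w = p
      · subst hwp
        rw [Function.update_self, (hsu u hu).1]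
      · rw [Function.update_of_ne hwp, hP.color w (by omega) hw' u hu]
    · rw [h.load_merge ht hp (fun u hu => (hsu u hu).2) (by omega) hu']
      exact hP.load_le u (by omega) hu'

/-- The entry for the parent comes from a state σ of t and an earlier state τ of the parent. The
vertex t takes its color from σ and the parent gets τ back. At a root any possible σ will do,
because no remaining vertex is affected. -/
theorem IsPartial.introduce {t : ℕ} (ht : t < n) {C ρ : ℕ → ℕ}
    (hP : IsPartial n Δ S AD c k A (t + 1) C ρ) (hr : par t = n → ∃ σ < S, A t t σ) :
    ∃ C' ρ', IsPartial n Δ S AD c k A t C' ρ' := by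
  classical
  rcases h.par_spec t ht with ⟨hpar, hroot⟩ | ⟨hp, -⟩
  · obtain ⟨σ, hσ, hA⟩ := hr hpar
    refine ⟨Function.update C t (c σ t), Function.update ρ t σ, fun w hw hw' => ?_,
      fun w hw hw' => ?_, fun w hw hw' u hu => ?_, fun u hu hu' => ?_⟩
    · by_cases hwt : w = t
      · rw [hwt, Function.update_self]; exact hσ
      · rw [Function.update_of_ne hwt]; exact hP.lt w (by omega) hw'
    · by_cases hwt : w = t
      · rw [hwt, Function.update_self]; exact hA
      · rw [Function.update_of_ne hwt]
        exact (h.succ_ne t ht w hw' _ (hP.lt w (by omega) hw') (by omega)).mp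
          (hP.mem w (by omega) hw')
    · by_cases hwt : w = t
      · subst hwt
        rcases hu with rfl | hu
        · rw [Function.update_self, Function.update_self]
        · exact absurd hu (hroot u)
      · have := bag_of_le (t := t) (by omega) hu
        rw [Function.update_of_ne hwt, Function.update_of_ne (by omega),
          hP.color w (by omega) hw' u hu]
    · by_cases hut : u = t
      · subst hut
        rw [h.load_self ht, Function.update_self, Finset.filter_false_of_mem
          (fun u _ h' => hroot u h'.1)]
        simpa using (h.state_le σ hσ u hu').2
      · rw [h.load_root ht hroot (by omega) hu']
        refine le_of_eq_of_le (load_congr (Function.update_of_ne hut _ _) (fun w hw _ => ?_)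
          fun w hw _ => ?_) (hP.load_le u (by omega) hu')
        · exact Function.update_of_ne (by omega) _ _
        · exact Function.update_of_ne (by omega) _ _
  · have hpA := hP.mem (par t) hp.1 hp.2.1
    rw [h.succ_par t ht (par t) hp.2.1 _ (hP.lt _ hp.1 hp.2.1) rfl] at hpA
    obtain ⟨σ, hσ, τ, hτ, hAσ, hAτ, hdeg, hm⟩ := hpA
    have hpt : par t ≠ t := hp.1.ne'
    have hcolor := hP.color _ hp.1 hp.2.1
    set C' := Function.update C t (c σ t) with hC'
    set ρ' := Function.update (Function.update ρ (par t) τ) t σ with hρ'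
    have hCt : C' t = c σ t := Function.update_self ..
    have hCu : ∀ u, t < u → C' u = C u := fun u hu => Function.update_of_ne (by omega) _ _
    have hρt : ρ' t = σ := Function.update_self ..
    have hρp : ρ' (par t) = τ := by rw [hρ', Function.update_of_ne hpt, Function.update_self]
    have hρw : ∀ w, w ≠ t → w ≠ par t → ρ' w = ρ w := fun w h1 h2 => by
      rw [hρ', Function.update_of_ne h1, Function.update_of_ne h2]
    have hσC : ∀ u, Bag n AD t u → c σ u = C' u := by
      rintro u (rfl | hu)
      · exact hCt.symm
      · have hb := (h.later_bag_par ht hu).2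
        rw [hCu u hu.1, ← hcolor u hb, (hm u hb).1, ((hm u hb).2.1 hu).1]
    refine ⟨C', ρ', fun w hw hw' => ?_, fun w hw hw' => ?_, fun w hw hw' u hu => ?_,
      fun u hu hu' => ?_⟩
    · by_cases hwt : w = t
      · rw [hwt, hρt]; exact hσ
      · by_cases hwp : w = par t
        · rw [hwp, hρp]; exact hτ
        · rw [hρw w hwt hwp]; exact hP.lt w (by omega) hw'
    · by_cases hwt : w = t
      · rw [hwt, hρt]; exact hAσ
      · by_cases hwp : w = par t
        · rw [hwp, hρp]; exact hAτ
        · rw [hρw w hwt hwp]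
          exact (h.succ_ne t ht w hw' _ (hP.lt w (by omega) hw') hwp).mp (hP.mem w (by omega) hw')
    · by_cases hwt : w = t
      · subst hwt
        rw [hρt]
        exact hσC u hu
      · have := bag_of_le (t := t) (by omega) hu
        rw [hCu u this]
        by_cases hwp : w = par t
        · subst hwp
          rw [hρp, ← (hm u hu).1]
          exact hcolor u hu
        · rw [hρw w hwt hwp, hP.color w (by omega) hw' u hu]
    · by_cases hut : u = t
      · subst hut
        rw [h.load_self ht, hρt]
        convert hdeg using 3
        refine Finset.filter_congr fun w _ => and_congr_right fun hl => ?_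
        rw [hσC w (.inr hl), hσC u (.inl rfl)]
      · rw [← h.load_merge ht hp (s := ρ (par t)) (fun w hw => ?_) (by omega) hu']
        · refine le_of_eq_of_le (load_congr (hCu u (by omega)) (fun w hw _ => hCu w (by omega))
            fun w hw _ => ?_) (hP.load_le u (by omega) hu')
          by_cases hwp : w = par t
          · rw [hwp, Function.update_self]
          · rw [Function.update_of_ne hwp, hρw w (by omega) hwp]
        · rw [hρp, hρt]
          by_cases hl : Later n AD t w
          · rw [if_pos hl, ((hm w hw).2.1 hl).2, hσC w (.inr hl), hσC t (.inl rfl), add_assoc]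
          · rw [if_neg hl, (hm w hw).2.2 hl, add_zero]

open Classical in
/-- The dynamic program is correct. -/
theorem correct :
    (∃ C : ℕ → ℕ, (∀ u < n, C u < χ) ∧
      ∀ u < n, ((Finset.range n).filter fun x => AD u x ∧ C x = C u).card ≤ Δ) ↔
    ∀ v < n, par v = n → ∃ σ < S, A v v σ := by
  -- When nothing has been eliminated the counts vanish, and the load of a vertex is its degree in
  -- its color class.
  have hload : ∀ (C ρ : ℕ → ℕ), (∀ w < n, ∀ u, Bag n AD w u → k (ρ w) u = 0) → ∀ u,
      load n AD k 0 C ρ u = ((Finset.range n).filter fun x => AD u x ∧ C x = C u).card := by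
    intro C ρ hρ u
    rw [load, Finset.card_filter, ← Finset.range_eq_Ico]
    refine Finset.sum_congr rfl fun w hw => ?_
    rw [Finset.mem_range] at hw
    split_ifs <;> simp_all
  have hzero : ∀ {C ρ : ℕ → ℕ}, IsPartial n Δ S AD c k A 0 C ρ →
      ∀ w < n, ∀ u, Bag n AD w u → k (ρ w) u = 0 := fun hP w hw =>
    (h.zero w hw _ (hP.lt w (Nat.zero_le _) hw)).mp (hP.mem w (Nat.zero_le _) hw)
  constructor
  · rintro ⟨C, hC, hdeg⟩
    have h0 : ∃ ρ, IsPartial n Δ S AD c k A 0 C ρ := by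
      have : ∀ w, ∃ s, w < n → s < S ∧ ∀ u, Bag n AD w u → c s u = C u ∧ k s u = 0 := by
        intro w
        by_cases hw : w < n
        · obtain ⟨s, hs, hs'⟩ := h.exists_state w hw C (fun _ => 0)
            fun u hu => ⟨hC u (bag_lt hw hu), Nat.zero_le _⟩
          exact ⟨s, fun _ => ⟨hs, hs'⟩⟩
        · exact ⟨0, fun h' => absurd h' hw⟩
      choose ρ hρ using this
      refine ⟨ρ, fun w _ hw => (hρ w hw).1, fun w _ hw => ?_,
        fun w _ hw u hu => ((hρ w hw).2 u hu).1, fun u _ hu => ?_⟩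
      · exact (h.zero w hw _ (hρ w hw).1).mpr fun u hu => ((hρ w hw).2 u hu).2
      · rw [hload C ρ fun w hw u hu => ((hρ w hw).2 u hu).2]
        exact hdeg u hu
    have hall : ∀ t ≤ n, ∃ ρ, IsPartial n Δ S AD c k A t C ρ := by
      intro t
      induction t with
      | zero => exact fun _ => h0
      | succ t ih =>
        intro ht
        obtain ⟨ρ, hρ⟩ := ih (by omega)
        exact (IsPartial.eliminate h (by omega) hρ).1
    intro v hv _
    obtain ⟨ρ, hρ⟩ := hall v hv.le
    exact (IsPartial.eliminate h hv hρ).2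
  · intro hroot
    -- The induction descends from t = n, where the conditions on a partial solution are void.
    have hall : ∀ d ≤ n, ∃ C ρ, IsPartial n Δ S AD c k A (n - d) C ρ := by
      intro d
      induction d with
      | zero =>
        exact fun _ => ⟨fun _ => 0, fun _ => 0, fun w _ _ => by omega, fun w _ _ => by omega,
          fun w _ _ => by omega, fun w _ _ => by omega⟩
      | succ d ih =>
        intro hd
        obtain ⟨C, ρ, hP⟩ := ih (by omega)
        rw [show n - d = n - (d + 1) + 1 by omega] at hP
        exact IsPartial.introduce h (by omega) hP (hroot _ (by omega))
    obtain ⟨C, ρ, hP⟩ := hall n le_rfl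
    rw [Nat.sub_self] at hP
    refine ⟨C, fun u hu => ?_, fun u hu => ?_⟩
    · rw [← hP.color u (Nat.zero_le _) hu u (.inl rfl)]
      exact (h.state_le _ (hP.lt u (Nat.zero_le _) hu) u hu).1
    · rw [← hload C ρ (hzero hP)]
      exact hP.load_le u (Nat.zero_le _) hu

end DynamicProgram

end DefectiveColoring

namespace DefectiveColoring

open RAM TExpr

/-! ### The algorithm in the table language -/

/-- The entry `x` of a table with one index. -/
def look₁ (i : Fin 16) (x : TExpr) : TExpr := .look i x (.const 0) (.const 0)

/-- The entry `x`, `y` of a table with two indices. -/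
def look₂ (i : Fin 16) (x y : TExpr) : TExpr := .look i x y (.const 0)

/-- Adjacency in the input graph. -/
def adjExpr (u v : TExpr) : TExpr := .tab 0 (.add (.mul u (.var 0)) v)

/-- The vertex `v` does not occur in the elimination order before position `8`. -/
def remainsExpr (v : Fin 32) : TExpr :=
  .and (.lt (.var v) (.var 0))
    (.not (.ex 15 (.and (.lt (.var 15) (.var 8)) (.eq (look₁ 1 (.var 15)) (.var v)))))

/-- Table `1`: a perfect elimination order. -/
def orderExpr : TExpr :=
  .least 11 12 <| .and (remainsExpr 11) <| .all 13 <| .all 14 <|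
    .imp (.and (remainsExpr 13) <| .and (remainsExpr 14) <|
      .and (adjExpr (.var 11) (.var 13)) <| .and (adjExpr (.var 11) (.var 14)) <|
      .not (.eq (.var 13) (.var 14)))
    (adjExpr (.var 13) (.var 14))

/-- Table `2`: adjacency of positions in the elimination order. -/
def orderedAdjExpr : TExpr :=
  .and (.lt (.var 8) (.var 0)) <| .and (.lt (.var 9) (.var 0)) <|
    adjExpr (look₁ 1 (.var 8)) (look₁ 1 (.var 9))

/-- The number of vertices after the vertex `v`. -/
def revExpr (v : TExpr) : TExpr := .sub (.sub (.var 0) (.const 1)) v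

/-- Table `3`: a greedy proper coloring of the vertices in reverse order. -/
def slotExpr : TExpr :=
  .least 11 12 <| .not <| .ex 13 <| .and (.lt (.var 13) (.var 8)) <|
    .and (look₂ 2 (revExpr (.var 8)) (revExpr (.var 13))) (.eq (look₁ 3 (.var 13)) (.var 11))

/-- Table `4`: the first later neighbor of a vertex, or `n`. -/
def parentExpr : TExpr :=
  .least 11 12 <| .and (.lt (.var 8) (.var 11)) <|
    .or (.not (.lt (.var 11) (.var 0))) (look₂ 2 (.var 8) (.var 11))

/-- Tables `5` and `7`: division by the value of `d`. -/
def divExpr (i : Fin 16) (d : TExpr) : TExpr :=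
  .ite (.lt (.var 8) d) (.const 0) (.add (look₁ i (.sub (.var 8) d)) (.const 1))

/-- Tables `6` and `8`: the remainder modulo the value of `d`. -/
def modExpr (i : Fin 16) (d : TExpr) : TExpr :=
  .ite (.lt (.var 8) d) (.var 8) (look₁ i (.sub (.var 8) d))

/-- Table `9`: the digits of numbers in base `K`. -/
def digitExpr : TExpr :=
  .ite (.eq (.var 8) (.const 0)) (look₁ 6 (.var 9))
    (look₂ 9 (.sub (.var 8) (.const 1)) (look₁ 5 (.var 9)))

/-- The digit of a state that belongs to a vertex. -/
def entryExpr : TExpr := look₂ 9 (look₁ 3 (revExpr (.var 9))) (.var 8)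

/-- Table `10`: the color of a vertex in a state. -/
def colorExpr : TExpr := look₁ 7 entryExpr

/-- Table `11`: the number of eliminated neighbors of the same color of a vertex in a state. -/
def degreeExpr : TExpr := look₁ 8 entryExpr

/-- `Later` in the table language. -/
def laterExpr (v u : TExpr) : TExpr := .and (.lt v u) (.and (.lt u (.var 0)) (look₂ 2 v u))

/-- `Bag` in the table language. -/
def bagExpr (w u : TExpr) : TExpr := .or (.eq u w) (laterExpr w u)

/-- `Merges` in the table language. -/
def mergesExpr (v p σ τ s : TExpr) : TExpr :=
  .and (.not (.lt (.var 2) (.add (look₂ 11 σ v) (.count 13 (.and (laterExpr v (.var 13))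
    (.eq (look₂ 10 σ (.var 13)) (look₂ 10 σ v))))))) <|
  .all 13 <| .imp (bagExpr p (.var 13)) <|
    .and (.eq (look₂ 10 s (.var 13)) (look₂ 10 τ (.var 13))) <|
    .and (.imp (laterExpr v (.var 13)) <|
      .and (.eq (look₂ 10 τ (.var 13)) (look₂ 10 σ (.var 13))) <|
      .eq (look₂ 11 s (.var 13)) (.add (.add (look₂ 11 τ (.var 13)) (look₂ 11 σ (.var 13)))
        (.ite (.eq (look₂ 10 σ (.var 13)) (look₂ 10 σ v)) (.const 1) (.const 0)))) <|
    .imp (.not (laterExpr v (.var 13))) <|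
      .eq (look₂ 11 s (.var 13)) (look₂ 11 τ (.var 13))

/-- Table `12`: the possible states. -/
def stateExpr : TExpr :=
  .ite (.eq (.var 8) (.const 0))
    (.all 11 (.imp (bagExpr (.var 9) (.var 11))
      (.eq (look₂ 11 (.var 10) (.var 11)) (.const 0)))) <|
  .ite (.eq (.var 9) (look₁ 4 (.sub (.var 8) (.const 1))))
    (.ex 11 <| .and (.lt (.var 11) (.var 4)) <| .ex 12 <| .and (.lt (.var 12) (.var 4)) <|
      .and (.look 12 (.sub (.var 8) (.const 1)) (.sub (.var 8) (.const 1)) (.var 11)) <|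
      .and (.look 12 (.sub (.var 8) (.const 1)) (.var 9) (.var 12)) <|
      mergesExpr (.sub (.var 8) (.const 1)) (.var 9) (.var 11) (.var 12) (.var 10))
    (.look 12 (.sub (.var 8) (.const 1)) (.var 9) (.var 10))

/-- The answer. -/
def answerExpr : TExpr :=
  .ite (.and (.all 11 (.imp (.lt (.var 11) (.var 0)) (.lt (look₁ 3 (.var 11)) (.var 3))))
    (.all 11 (.imp (.and (.lt (.var 11) (.var 0)) (.eq (look₁ 4 (.var 11)) (.var 0)))
      (.ex 12 (.and (.lt (.var 12) (.var 4)) (.look 12 (.var 11) (.var 11) (.var 12)))))))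
    (.const 1) (.const 0)

/-- The tables in the order in which they are filled. -/
def tables : List (Fin 16 × TExpr) :=
  [(1, orderExpr), (2, orderedAdjExpr), (3, slotExpr), (4, parentExpr), (5, divExpr 5 (.var 3)),
    (6, modExpr 6 (.var 3)), (7, divExpr 7 (.var 5)), (8, modExpr 8 (.var 5)), (9, digitExpr),
    (10, colorExpr), (11, degreeExpr), (12, stateExpr)]

theorem pairwise_tables : tables.Pairwise fun a b => a.1 < b.1 := by
  simp [tables]

/-! ### Contents of the tables: elimination order, slots and digits -/

/-- All tables are filled. -/
structure Tabulated (N n χ Δ K S : ℕ) (inp : ℕ → ℕ) (ρ : Env) (𝕋 : Tables) : Prop where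
  env : IsParameterEnv ρ n χ Δ K S
  input : 𝕋 0 = inp
  filled : ∀ a ∈ tables, ∀ x < N, ∀ y < N, ∀ z < N, IsFilledAt N a.1 a.2 ρ 𝕋 x y z
  bound : N = n + S + 1
  hK : K = χ * (Δ + 1)
  hS : S = K ^ K
  K_pos : 0 < K

namespace Tabulated

variable {N n χ Δ K S : ℕ} {inp : ℕ → ℕ} {ρ : Env} {𝕋 : Tables}

theorem K_le (h : Tabulated N n χ Δ K S inp ρ 𝕋) : K ≤ S := by
  rw [h.hS]; exact Nat.le_self_pow h.K_pos.ne' K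

/-- Division is tabulated by the recurrence x / d = (x - d) / d + 1; row x - d precedes row x
because d is positive. -/
theorem div_spec (h : Tabulated N n χ Δ K S inp ρ 𝕋) {i : Fin 16} {v : Fin 32} {d : ℕ}
    (hi : (i, divExpr i (.var v)) ∈ tables) (hv : v ≠ 8 ∧ v ≠ 9 ∧ v ≠ 10) (hd : ρ v = d)
    (hd0 : 0 < d) : ∀ x < N, 𝕋 i (ix N x 0 0) = x / d := by
  intro x
  induction x using Nat.strong_induction_on with
  | _ x ih =>
    intro hx
    obtain ⟨𝕋', -, h2, h3⟩ := h.filled _ hi x hx 0 (by omega) 0 (by omega)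
    simp only at h2 h3
    have hev : indexEnv ρ x 0 0 v = d := by simp [indexEnv, hv.1, hv.2.1, hv.2.2, hd]
    have hex : indexEnv ρ x 0 0 8 = x := by simp [indexEnv]
    rw [h3, divExpr, eval_ite]
    simp only [holds_lt, eval, look₁, eval_look, hev, hex]
    split_ifs with hlt
    · rw [Nat.div_eq_of_lt hlt]
    · rw [h2 _ (by omega) 0 (by omega) 0 (by omega), ih _ (by omega) (by omega),
        Nat.div_eq_sub_div hd0 (by omega : d ≤ x)]

theorem mod_spec (h : Tabulated N n χ Δ K S inp ρ 𝕋) {i : Fin 16} {v : Fin 32} {d : ℕ}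
    (hi : (i, modExpr i (.var v)) ∈ tables) (hv : v ≠ 8 ∧ v ≠ 9 ∧ v ≠ 10) (hd : ρ v = d)
    (hd0 : 0 < d) : ∀ x < N, 𝕋 i (ix N x 0 0) = x % d := by
  intro x
  induction x using Nat.strong_induction_on with
  | _ x ih =>
    intro hx
    obtain ⟨𝕋', -, h2, h3⟩ := h.filled _ hi x hx 0 (by omega) 0 (by omega)
    simp only at h2 h3
    have hev : indexEnv ρ x 0 0 v = d := by simp [indexEnv, hv.1, hv.2.1, hv.2.2, hd]
    have hex : indexEnv ρ x 0 0 8 = x := by simp [indexEnv]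
    rw [h3, modExpr, eval_ite]
    simp only [holds_lt, eval, look₁, eval_look, hev, hex]
    split_ifs with hlt
    · rw [Nat.mod_eq_of_lt hlt]
    · rw [h2 _ (by omega) 0 (by omega) 0 (by omega), ih _ (by omega) (by omega),
        Nat.mod_eq_sub_mod (by omega : d ≤ x)]

/-- Digit j + 1 of s is digit j of s / K, so the recursion runs over the position of the digit and
uses the division table. -/
theorem digit_spec (h : Tabulated N n χ Δ K S inp ρ 𝕋) :
    ∀ j < N, ∀ s < N, 𝕋 9 (ix N j s 0) = s / K ^ j % K := by
  intro j
  induction j with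
  | zero =>
    intro hj s hs
    obtain ⟨𝕋', h1, h2, h3⟩ := h.filled (9, digitExpr) (by simp [tables]) 0 hj s hs 0 (by omega)
    simp only at h1 h2 h3
    rw [h3, digitExpr, eval_ite]
    simp only [holds_eq, eval, look₁, look₂, eval_look, indexEnv]
    simp only [h1 6 (by decide)]
    simp [h.mod_spec (i := 6) (v := 3) (by simp [tables]) (by decide) h.env.hK h.K_pos s hs]
  | succ j ih =>
    intro hj s hs
    obtain ⟨𝕋', h1, h2, h3⟩ := h.filled (9, digitExpr) (by simp [tables]) (j + 1) hj s hs 0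
      (by omega)
    simp only at h1 h2 h3
    have hdiv : s / K < N := (Nat.div_le_self _ _).trans_lt hs
    rw [h3, digitExpr, eval_ite]
    simp only [holds_eq, eval, look₁, look₂, eval_look, indexEnv]
    simp only [h1 5 (by decide)]
    simp [h.div_spec (i := 5) (v := 3) (by simp [tables]) (by decide) h.env.hK h.K_pos s hs]
    rw [h2 j (by omega) _ hdiv 0 (by omega), ih (by omega) _ hdiv, Nat.div_div_eq_div_mul,
      pow_succ']

/-- The slot of a vertex. -/
def slot (N n : ℕ) (𝕋 : Tables) (u : ℕ) : ℕ := 𝕋 3 (ix N (n - 1 - u) 0 0)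

/-- A digit is below K = χ(Δ + 1); its quotient by Δ + 1 is the color and its remainder the count.
-/
theorem color_spec (h : Tabulated N n χ Δ K S inp ρ 𝕋) {s u : ℕ} (hs : s < S) (hu : u < n)
    (hslot : slot N n 𝕋 u < K) :
    𝕋 10 (ix N s u 0) = s / K ^ slot N n 𝕋 u % K / (Δ + 1) := by
  have hN := h.bound
  have hKS := h.K_le
  obtain ⟨𝕋', h1, h2, h3⟩ := h.filled (10, colorExpr) (by simp [tables]) s (by omega) u (by omega) 0
    (by omega)
  simp only at h1 h2 h3
  rw [h3, colorExpr, entryExpr]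
  simp only [revExpr, eval, look₁, look₂, eval_look, indexEnv]
  simp only [h1 7 (by decide), h1 9 (by decide), h1 3 (by decide)]
  have hn := h.env.hn
  simp [hn]
  change 𝕋 7 (ix N (𝕋 9 (ix N (slot N n 𝕋 u) s 0)) 0 0) = _
  rw [h.digit_spec _ (by omega) _ (by omega)]
  exact h.div_spec (i := 7) (v := 5) (by simp [tables]) (by decide) h.env.hD (by omega) _
    ((Nat.mod_lt _ h.K_pos).trans_le (by omega))

theorem degree_spec (h : Tabulated N n χ Δ K S inp ρ 𝕋) {s u : ℕ} (hs : s < S) (hu : u < n)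
    (hslot : slot N n 𝕋 u < K) :
    𝕋 11 (ix N s u 0) = s / K ^ slot N n 𝕋 u % K % (Δ + 1) := by
  have hN := h.bound
  have hKS := h.K_le
  obtain ⟨𝕋', h1, h2, h3⟩ := h.filled (11, degreeExpr) (by simp [tables]) s (by omega) u (by omega)
    0 (by omega)
  simp only at h1 h2 h3
  rw [h3, degreeExpr, entryExpr]
  simp only [revExpr, eval, look₁, look₂, eval_look, indexEnv]
  simp only [h1 8 (by decide), h1 9 (by decide), h1 3 (by decide)]
  have hn := h.env.hn
  simp [hn]
  change 𝕋 8 (ix N (𝕋 9 (ix N (slot N n 𝕋 u) s 0)) 0 0) = _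
  rw [h.digit_spec _ (by omega) _ (by omega)]
  exact h.mod_spec (i := 8) (v := 5) (by simp [tables]) (by decide) h.env.hD (by omega) _
    ((Nat.mod_lt _ h.K_pos).trans_le (by omega))

/-- The vertex `u` does not occur among the first `x` vertices of the elimination order. -/
def Remains (N n : ℕ) (𝕋 : Tables) (x u : ℕ) : Prop := u < n ∧ ∀ t < x, 𝕋 1 (ix N t 0 0) ≠ u

/-- The vertex `v` is simplicial when the first `x` vertices are eliminated. -/
def Eligible (N n : ℕ) (inp : ℕ → ℕ) (𝕋 : Tables) (x v : ℕ) : Prop :=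
  Remains N n 𝕋 x v ∧ ∀ a b, Remains N n 𝕋 x a → Remains N n 𝕋 x b → inp (v * n + a) ≠ 0 →
    inp (v * n + b) ≠ 0 → a ≠ b → inp (a * n + b) ≠ 0

theorem order_spec (h : Tabulated N n χ Δ K S inp ρ 𝕋) {x : ℕ} (hx : x < n)
    (hex : ∃ v, Eligible N n inp 𝕋 x v) : Eligible N n inp 𝕋 x (𝕋 1 (ix N x 0 0)) := by
  have hN := h.bound
  obtain ⟨𝕋', h1, h2, h3⟩ := h.filled (1, orderExpr) (by simp [tables]) x (by omega) 0 (by omega) 0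
    (by omega)
  simp only at h1 h2 h3
  have hrem : ∀ (v : Fin 32) (ρ' : Env), ρ' 0 = n → ρ' 8 = x → v ≠ 15 →
      (Holds N 𝕋' ρ' (remainsExpr v) ↔ Remains N n 𝕋 x (ρ' v)) := by
    intro v ρ' h0 h8 hv
    rw [remainsExpr, holds_and, holds_lt, holds_not, holds_ex]
    simp only [holds_and, holds_lt, holds_eq, look₁, eval_look, eval]
    simp only [Function.update_self, Function.update_of_ne hv,
      Function.update_of_ne (by decide : (8 : Fin 32) ≠ 15), h0, h8, Remains]
    refine and_congr_right fun _ => ?_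
    push Not
    refine ⟨fun H t ht => ?_, fun H t _ ht => ?_⟩
    · rw [← h2 t ht 0 (by omega) 0 (by omega)]
      exact H t (by omega) ht
    · rw [h2 t ht 0 (by omega) 0 (by omega)]
      exact H t ht
  -- The first factor of the product is below N, so the cap has no effect.
  have hadj : ∀ (v w : Fin 32) (ρ' : Env), ρ' 0 = n → ρ' v < N →
      (Holds N 𝕋' ρ' (adjExpr (.var v) (.var w)) ↔ inp (ρ' v * n + ρ' w) ≠ 0) := by
    intro v w ρ' h0 hv
    simp only [Holds, adjExpr, eval, h0, h1 0 (by decide), h.input, min_eq_left hv.le]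
  have hn := h.env.hn
  have key := eval_least (N := N) (𝕋 := 𝕋') (ρ := indexEnv ρ x 0 0) (v := 11) (w := 12)
    (e := .and (remainsExpr 11) <| .all 13 <| .all 14 <|
    .imp (.and (remainsExpr 13) <| .and (remainsExpr 14) <|
      .and (adjExpr (.var 11) (.var 13)) <| .and (adjExpr (.var 11) (.var 14)) <|
      .not (.eq (.var 13) (.var 14)))
    (adjExpr (.var 13) (.var 14))) (p := Eligible N n inp 𝕋 x) (by decide) ?_ ?_
  · rw [h3]
    exact key.2.1
  · intro q y
    rw [holds_and, hrem _ _ (by simp [indexEnv, hn]) (by simp [indexEnv]) (by decide)]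
    simp only [Function.update_self, Eligible]
    refine and_congr_right fun hy => ?_
    have hyN : y < N := by have := hy.1; omega
    simp only [holds_all, holds_imp, holds_and, holds_not, holds_eq]
    refine ⟨fun H a b ha hb => ?_, fun H a ha b hb => ?_⟩
    · have := H a (by have := ha.1; omega) b (by have := hb.1; omega)
      rw [hrem _ _ (by simp [indexEnv, hn]) (by simp [indexEnv]) (by decide),
        hrem _ _ (by simp [indexEnv, hn]) (by simp [indexEnv]) (by decide),
        hadj _ _ _ (by simp [indexEnv, hn]) (by simpa using hyN),
        hadj _ _ _ (by simp [indexEnv, hn]) (by simpa using hyN),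
        hadj _ _ _ (by simp [indexEnv, hn]) (by have := ha.1; simp; omega)] at this
      simp only [eval] at this
      simp at this
      exact fun h1 h2 h3 => this ha hb h1 h2 h3
    · rw [hrem _ _ (by simp [indexEnv, hn]) (by simp [indexEnv]) (by decide),
        hrem _ _ (by simp [indexEnv, hn]) (by simp [indexEnv]) (by decide),
        hadj _ _ _ (by simp [indexEnv, hn]) (by simpa using hyN),
        hadj _ _ _ (by simp [indexEnv, hn]) (by simpa using hyN),
        hadj _ _ _ (by simp [indexEnv, hn]) (by simpa using ha)]
      simp only [eval]
      simp
      exact fun h1 h2 h3 h4 h5 => H a b h1 h2 h3 h4 h5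
  · obtain ⟨v, hv⟩ := hex
    exact ⟨v, by have := hv.1.1; omega, hv⟩

/-- Adjacency of positions in the elimination order. -/
def OrderedAdj (N : ℕ) (𝕋 : Tables) (u v : ℕ) : Prop := 𝕋 2 (ix N u v 0) ≠ 0

theorem orderedAdj_spec (h : Tabulated N n χ Δ K S inp ρ 𝕋) {u v : ℕ} (hu : u < n) (hv : v < n)
    (hlt : 𝕋 1 (ix N u 0 0) < n) :
    OrderedAdj N 𝕋 u v ↔ inp (𝕋 1 (ix N u 0 0) * n + 𝕋 1 (ix N v 0 0)) ≠ 0 := by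
  have hN := h.bound
  obtain ⟨𝕋', h1, h2, h3⟩ := h.filled (2, orderedAdjExpr) (by simp [tables]) u (by omega) v
    (by omega) 0 (by omega)
  simp only at h1 h2 h3
  rw [OrderedAdj, h3, holds_iff, orderedAdjExpr, holds_and, holds_and, holds_lt, holds_lt]
  simp only [Holds, adjExpr, look₁, eval_look, eval, indexEnv]
  simp only [h1 0 (by decide), h1 1 (by decide), h.input]
  simp [h.env.hn, hu, hv, min_eq_left (hlt.le.trans (by omega : n ≤ N))]

theorem parent_spec (h : Tabulated N n χ Δ K S inp ρ 𝕋) {v : ℕ} (hv : v < n) :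
    (𝕋 4 (ix N v 0 0) = n ∧ ∀ u, ¬ Later n (OrderedAdj N 𝕋) v u) ∨
    (Later n (OrderedAdj N 𝕋) v (𝕋 4 (ix N v 0 0)) ∧
      ∀ u, Later n (OrderedAdj N 𝕋) v u → 𝕋 4 (ix N v 0 0) ≤ u) := by
  have hN := h.bound
  obtain ⟨𝕋', h1, h2, h3⟩ := h.filled (4, parentExpr) (by simp [tables]) v (by omega) 0
    (by omega) 0 (by omega)
  simp only at h1 h2 h3
  have hn := h.env.hn
  have hSpos : 0 < S := h.K_pos.trans_le h.K_le
  have key := eval_least (N := N) (𝕋 := 𝕋') (ρ := indexEnv ρ v 0 0) (v := 11) (w := 12)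
    (e := .and (.lt (.var 8) (.var 11)) <|
      .or (.not (.lt (.var 11) (.var 0))) (look₂ 2 (.var 8) (.var 11)))
    -- u = n always qualifies; it is the default value when there is no later neighbor.
    (p := fun u => v < u ∧ (n ≤ u ∨ OrderedAdj N 𝕋 v u)) (by decide) ?_
    ⟨n, by omega, hv, .inl le_rfl⟩
  · rw [show eval N 𝕋' (TExpr.least 11 12 _) _ = 𝕋 4 (ix N v 0 0) from h3.symm] at key
    obtain ⟨-, ⟨k1, k2⟩, k3⟩ := key
    have hle : 𝕋 4 (ix N v 0 0) ≤ n := by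
      by_contra hc
      exact k3 n (by omega) ⟨hv, .inl le_rfl⟩
    have hmin : ∀ u, Later n (OrderedAdj N 𝕋) v u → 𝕋 4 (ix N v 0 0) ≤ u := by
      intro u hu
      by_contra hc
      exact k3 u (by omega) ⟨hu.1, .inr hu.2.2⟩
    rcases hle.eq_or_lt with heq | hlt
    · refine .inl ⟨heq, fun u hu => ?_⟩
      have := hmin u hu
      have := hu.2.1
      omega
    · exact .inr ⟨⟨k1, hlt, k2.resolve_left (by omega)⟩, hmin⟩
  · intro q y
    rw [holds_and, holds_or, holds_not, holds_lt, holds_lt]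
    simp only [Holds, look₂, eval_look, eval, indexEnv]
    simp [hn, h1 2 (by decide), OrderedAdj]

/-- This is the greedy rule: the least slot not used by a later neighbor. The slot of v is kept in
row n - 1 - v because a row can refer only to earlier rows. -/
theorem slot_spec (h : Tabulated N n χ Δ K S inp ρ 𝕋) {v : ℕ} (hv : v < n) :
    (∀ u, Later n (OrderedAdj N 𝕋) v u → slot N n 𝕋 u ≠ slot N n 𝕋 v) ∧
      ∀ q < slot N n 𝕋 v, ∃ u, Later n (OrderedAdj N 𝕋) v u ∧ slot N n 𝕋 u = q := by
  have hN := h.bound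
  obtain ⟨𝕋', h1, h2, h3⟩ := h.filled (3, slotExpr) (by simp [tables]) (n - 1 - v) (by omega) 0
    (by omega) 0 (by omega)
  simp only at h1 h2 h3
  have hn := h.env.hn
  have key := eval_least (N := N) (𝕋 := 𝕋') (ρ := indexEnv ρ (n - 1 - v) 0 0) (v := 11) (w := 12)
    (e := .not <| .ex 13 <| .and (.lt (.var 13) (.var 8)) <|
    .and (look₂ 2 (revExpr (.var 8)) (revExpr (.var 13))) (.eq (look₁ 3 (.var 13)) (.var 11)))
    (p := fun q => ¬ ∃ u, Later n (OrderedAdj N 𝕋) v u ∧ slot N n 𝕋 u = q) (by decide) ?_ ?_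
  · rw [show eval N 𝕋' (TExpr.least 11 12 _) _ = slot N n 𝕋 v from h3.symm] at key
    obtain ⟨-, k2, k3⟩ := key
    push Not at k2
    exact ⟨k2, fun q hq => not_not.mp (k3 q hq)⟩
  · intro q y
    rw [holds_not, holds_ex, not_iff_not]
    simp only [holds_and, holds_lt, holds_eq]
    simp only [Holds, look₁, look₂, revExpr, eval_look, eval, indexEnv]
    simp only [h1 2 (by decide)]
    simp [hn]
    constructor
    · rintro ⟨t, ht, ht1, ht2, ht3⟩
      refine ⟨n - 1 - t, ⟨by omega, by omega, ?_⟩, ?_⟩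
      · rwa [show n - 1 - (n - 1 - v) = v by omega] at ht2
      · rw [← ht3, h2 t ht1 0 (by omega) 0 (by omega), slot, show n - 1 - (n - 1 - t) = t by omega]
    · rintro ⟨u, ⟨hu1, hu2, hu3⟩, hu4⟩
      refine ⟨n - 1 - u, by omega, by omega, ?_, ?_⟩
      · rwa [show n - 1 - (n - 1 - v) = v by omega, show n - 1 - (n - 1 - u) = u by omega]
      · rw [h2 _ (by omega) 0 (by omega) 0 (by omega)]
        exact hu4
  -- The n vertices cannot occupy all of the N > n values.
  · by_contra hc
    push Not at hc
    have : Finset.range N ⊆ (Finset.range n).image (slot N n 𝕋) := by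
      intro q hq
      obtain ⟨u, hu, rfl⟩ := hc q (Finset.mem_range.mp hq)
      exact Finset.mem_image_of_mem _ (Finset.mem_range.mpr hu.2.1)
    have := (Finset.card_le_card this).trans Finset.card_image_le
    simp at this
    omega

end Tabulated

end DefectiveColoring

/-! ### Contents of the tables: possible states and the answer -/

namespace DefectiveColoring

open RAM TExpr

namespace Tabulated

variable {N n χ Δ K S : ℕ} {inp : ℕ → ℕ} {ρ : Env} {𝕋 : Tables}

theorem holds_laterExpr {𝕋' : Tables} (h2 : 𝕋' 2 = 𝕋 2) {ρ' : Env} (hρ : ρ' 0 = n) (v u : TExpr) :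
    Holds N 𝕋' ρ' (laterExpr v u) ↔
      Later n (OrderedAdj N 𝕋) (v.eval N 𝕋' ρ') (u.eval N 𝕋' ρ') := by
  rw [laterExpr, holds_and, holds_and, holds_lt, holds_lt]
  simp only [Holds, look₂, eval_look, eval, h2, hρ]
  rfl

theorem holds_bagExpr {𝕋' : Tables} (h2 : 𝕋' 2 = 𝕋 2) {ρ' : Env} (hρ : ρ' 0 = n) (w u : TExpr) :
    Holds N 𝕋' ρ' (bagExpr w u) ↔
      Bag n (OrderedAdj N 𝕋) (w.eval N 𝕋' ρ') (u.eval N 𝕋' ρ') := by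
  rw [bagExpr, holds_or, holds_eq, holds_laterExpr h2 hρ]
  rfl

/-- The quantification over y expresses that the arguments do not depend on variable 13, which is
bound inside `mergesExpr`. Counting below N instead of below n makes no difference, since later
neighbors are below n. -/
theorem holds_mergesExpr (hN : n ≤ N) {𝕋' : Tables} (h2 : 𝕋' 2 = 𝕋 2) (h10 : 𝕋' 10 = 𝕋 10)
    (h11 : 𝕋' 11 = 𝕋 11) {ρ' : Env} (hρ : ρ' 0 = n) (hρ2 : ρ' 2 = Δ) {v p σ τ s : TExpr}
    {v' p' σ' τ' s' : ℕ} (hv : ∀ y, v.eval N 𝕋' (Function.update ρ' 13 y) = v')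
    (hp : ∀ y, p.eval N 𝕋' (Function.update ρ' 13 y) = p')
    (hσ : ∀ y, σ.eval N 𝕋' (Function.update ρ' 13 y) = σ')
    (hτ : ∀ y, τ.eval N 𝕋' (Function.update ρ' 13 y) = τ')
    (hs : ∀ y, s.eval N 𝕋' (Function.update ρ' 13 y) = s') (hpn : p' < n) :
    Holds N 𝕋' ρ' (mergesExpr v p σ τ s) ↔
      Merges n Δ (OrderedAdj N 𝕋) (fun s u => 𝕋 10 (ix N s u 0)) (fun s u => 𝕋 11 (ix N s u 0))
        v' p' σ' τ' s' := by
  classical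
  have hv0 : v.eval N 𝕋' ρ' = v' := by rw [← hv (ρ' 13), Function.update_eq_self]
  have hσ0 : σ.eval N 𝕋' ρ' = σ' := by rw [← hσ (ρ' 13), Function.update_eq_self]
  have h0 : ∀ y, Function.update ρ' 13 y 0 = n := fun y => by simp [hρ]
  rw [mergesExpr, holds_and, holds_not, holds_lt, holds_all, Merges]
  refine and_congr ?_ ?_
  · simp only [eval, look₂, eval_look, eval_count, hv0, hσ0, h11, hρ2, not_lt]
    simp only [holds_and, holds_laterExpr h2 (h0 _), holds_eq, eval_look, eval, hv, hσ, h10,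
      Function.update_self]
    rw [show (Finset.range N).filter (fun u => Later n (OrderedAdj N 𝕋) v' u ∧
      𝕋 10 (ix N σ' u 0) = 𝕋 10 (ix N σ' v' 0)) = (Finset.range n).filter (fun u =>
      Later n (OrderedAdj N 𝕋) v' u ∧ 𝕋 10 (ix N σ' u 0) = 𝕋 10 (ix N σ' v' 0)) from ?_]
    ext u
    simp only [Finset.mem_filter, Finset.mem_range]
    exact ⟨fun H => ⟨H.2.1.2.1, H.2⟩, fun H => ⟨H.1.trans_le hN, H.2⟩⟩
  · simp only [holds_imp, holds_and, holds_not, holds_bagExpr h2 (h0 _),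
      holds_laterExpr h2 (h0 _), holds_iff, holds_eq, look₂, eval_look, eval, hv, hp, hσ, hτ,
      hs, h10, h11, Function.update_self]
    exact ⟨fun H u hu => H u ((DynamicProgram.bag_lt hpn hu).trans_le hN) hu,
      fun H u _ hu => H u hu⟩

theorem state_zero (h : Tabulated N n χ Δ K S inp ρ 𝕋) {w s : ℕ} (hw : w < n) (hs : s < S) :
    𝕋 12 (ix N 0 w s) ≠ 0 ↔
      ∀ u, Bag n (OrderedAdj N 𝕋) w u → 𝕋 11 (ix N s u 0) = 0 := by
  have hN := h.bound
  obtain ⟨𝕋', h1, h2, h3⟩ := h.filled (12, stateExpr) (by simp [tables]) 0 (by omega) w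
    (by omega) s (by omega)
  simp only at h1 h2 h3
  have hn := h.env.hn
  have h0 : ∀ y, Function.update (indexEnv ρ 0 w s) 11 y 0 = n := fun y => by
    simp [indexEnv, hn]
  rw [h3, holds_iff, stateExpr, holds_ite, holds_eq]
  simp only [holds_all, holds_imp, holds_bagExpr (h1 2 (by decide)) (h0 _), holds_eq, look₂,
    eval_look, eval, h1 11 (by decide)]
  simp only [indexEnv]
  simp
  exact ⟨fun H u hu => H u ((DynamicProgram.bag_lt hw hu).trans (by omega)) hu,
    fun H u _ hu => H u hu⟩

/-- Time is the first index, so the entries for time t belong to an earlier row and are final when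
row t + 1 is computed. -/
theorem state_succ (h : Tabulated N n χ Δ K S inp ρ 𝕋) {t w s : ℕ} (ht : t < n) (hw : w < n)
    (hs : s < S) :
    𝕋 12 (ix N (t + 1) w s) ≠ 0 ↔
      (w = 𝕋 4 (ix N t 0 0) ∧ ∃ σ < S, ∃ τ < S, 𝕋 12 (ix N t t σ) ≠ 0 ∧ 𝕋 12 (ix N t w τ) ≠ 0 ∧
        Merges n Δ (OrderedAdj N 𝕋) (fun s u => 𝕋 10 (ix N s u 0)) (fun s u => 𝕋 11 (ix N s u 0))
          t w σ τ s) ∨ (w ≠ 𝕋 4 (ix N t 0 0) ∧ 𝕋 12 (ix N t w s) ≠ 0) := by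
  have hN := h.bound
  obtain ⟨𝕋', h1, h2, h3⟩ := h.filled (12, stateExpr) (by simp [tables]) (t + 1) (by omega) w
    (by omega) s (by omega)
  simp only at h1 h2 h3
  have hx : indexEnv ρ (t + 1) w s 8 = t + 1 := by simp [indexEnv]
  have hy : indexEnv ρ (t + 1) w s 9 = w := by simp [indexEnv]
  have hz : indexEnv ρ (t + 1) w s 10 = s := by simp [indexEnv]
  have hpar : (look₁ 4 (.sub (.var 8) (.const 1))).eval N 𝕋' (indexEnv ρ (t + 1) w s) =
      𝕋 4 (ix N t 0 0) := by
    simp [look₁, eval_look, eval, hx, h1 4 (by decide)]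
  have hprev : (TExpr.look 12 (.sub (.var 8) (.const 1)) (.var 9) (.var 10)).eval N 𝕋'
      (indexEnv ρ (t + 1) w s) = 𝕋 12 (ix N t w s) := by
    simp [eval_look, eval, hx, hy, hz]
    exact h2 t (by omega) w (by omega) s (by omega)
  rw [h3, holds_iff, stateExpr, holds_ite, holds_ite, holds_eq, holds_eq, hpar]
  simp only [Holds, hprev]
  have hne : ¬ eval N 𝕋' (.var 8) (indexEnv ρ (t + 1) w s) =
      eval N 𝕋' (.const 0) (indexEnv ρ (t + 1) w s) := by simp [eval, hx]
  simp only [hne, false_and, false_or, not_false_eq_true, true_and]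
  simp only [eval, hy]
  refine or_congr (and_congr_right fun _ => ?_) Iff.rfl
  change Holds N 𝕋' (indexEnv ρ (t + 1) w s) (.ex 11 _) ↔ _
  simp only [holds_ex, holds_and, holds_lt]
  have hmerge : ∀ σ τ, Holds N 𝕋' (Function.update (Function.update (indexEnv ρ (t + 1) w s) 11 σ)
      12 τ) (mergesExpr (.sub (.var 8) (.const 1)) (.var 9) (.var 11) (.var 12) (.var 10)) ↔
      Merges n Δ (OrderedAdj N 𝕋) (fun s u => 𝕋 10 (ix N s u 0)) (fun s u => 𝕋 11 (ix N s u 0))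
        t w σ τ s := by
    intro σ τ
    refine holds_mergesExpr (by omega) (h1 2 (by decide)) (h1 10 (by decide)) (h1 11 (by decide))
      ?_ ?_ ?_ ?_ ?_ ?_ ?_ hw
    · simp [indexEnv, h.env.hn]
    · simp [indexEnv, h.env.hΔ]
    all_goals intro y; simp [indexEnv, eval]
  simp only [hmerge]
  simp only [Holds, eval_look, eval, indexEnv]
  simp [h.env.hS]
  constructor
  · rintro ⟨σ, -, hσ, τ, -, hτ, k1, k2, k3⟩
    rw [h2 t (by omega) _ (by omega) _ (by omega)] at k1 k2
    exact ⟨σ, hσ, τ, hτ, k1, k2, k3⟩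
  · rintro ⟨σ, hσ, τ, hτ, k1, k2, k3⟩
    refine ⟨σ, by omega, hσ, τ, by omega, hτ, ?_, ?_, k3⟩
    · rwa [h2 t (by omega) _ (by omega) _ (by omega)]
    · rwa [h2 t (by omega) _ (by omega) _ (by omega)]

open Classical in
theorem answer_spec (h : Tabulated N n χ Δ K S inp ρ 𝕋) :
    answerExpr.eval N 𝕋 ρ = if (∀ v < n, slot N n 𝕋 v < K) ∧
      ∀ v < n, 𝕋 4 (ix N v 0 0) = n → ∃ σ < S, 𝕋 12 (ix N v v σ) ≠ 0 then 1 else 0 := by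
  have hN := h.bound
  rw [answerExpr, eval_ite]
  simp only [eval]
  refine if_congr ?_ rfl rfl
  simp only [holds_and, holds_all, holds_imp, holds_lt, holds_eq, holds_ex]
  simp only [Holds, look₁, eval_look, eval]
  simp [h.env.hn, h.env.hK, h.env.hS]
  refine and_congr ⟨fun H v hv => H (n - 1 - v) (by omega) (by omega), fun H v _ hv => ?_⟩
    ⟨fun H v hv h' => ?_, fun H v _ hv h' => ?_⟩
  · have := H (n - 1 - v) (by omega)
    rwa [slot, show n - 1 - (n - 1 - v) = v by omega] at this
  · obtain ⟨σ, -, hσ⟩ := H v (by omega) hv h'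
    exact ⟨σ, hσ⟩
  · obtain ⟨σ, hσ, hσ'⟩ := H v hv h'
    exact ⟨σ, by omega, hσ, hσ'⟩

end Tabulated

/-- Every sequence of `k` digits is the sequence of digits of a number. -/
theorem exists_digits {K : ℕ} (hK : 0 < K) (δ : ℕ → ℕ) (hδ : ∀ j, δ j < K) (k : ℕ) :
    ∃ s < K ^ k, ∀ j < k, s / K ^ j % K = δ j := by
  induction k generalizing δ with
  | zero => exact ⟨0, by simp, by simp⟩
  | succ k ih =>
    obtain ⟨s, hs, hs'⟩ := ih (fun j => δ (j + 1)) fun j => hδ _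
    refine ⟨K * s + δ 0, ?_, fun j hj => ?_⟩
    · rw [pow_succ']
      have := Nat.mul_le_mul_left K (Nat.succ_le_of_lt hs)
      have := hδ 0
      rw [Nat.mul_succ] at *
      omega
    · rcases j with _ | j
      · simp [Nat.mod_eq_of_lt (hδ 0)]
      · rw [pow_succ', ← Nat.div_div_eq_div_mul, Nat.mul_add_div hK, Nat.div_eq_of_lt (hδ 0),
          add_zero]
        exact hs' j (by omega)

end DefectiveColoring

/-! ### From the input graph to the dynamic program -/

namespace SimpleGraph

open Classical in
theorem isDefectiveColoring_iff {V : Type*} [Fintype V] {G : SimpleGraph V} {χ Δ : ℕ}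
    {c : V → Fin χ} : G.IsDefectiveColoring χ Δ c ↔
      ∀ u, (Finset.univ.filter fun x => G.Adj u x ∧ c x = c u).card ≤ Δ := by
  have key : ∀ (i : Fin χ) (u : (c ⁻¹' {i} : Set V)), (G.induce (c ⁻¹' {i})).degree u =
      (Finset.univ.filter fun x => G.Adj u x ∧ c x = c u).card := by
    rintro i ⟨u, hu⟩
    rw [← card_neighborFinset_eq_degree, ← Finset.card_map (Function.Embedding.subtype _)]
    congr 1
    ext x
    have hu' : c u = i := hu
    simp [hu', and_comm]
  constructor
  · intro h u
    exact (key (c u) ⟨u, rfl⟩).ge.trans ((degree_le_maxDegree _ _).trans (h (c u)))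
  · intro h i
    exact maxDegree_le_of_forall_degree_le _ _ fun u => (key i u).le.trans (h u)

end SimpleGraph

namespace DefectiveColoring

open RAM

variable {n : ℕ} {G : SimpleGraph (Fin n)}

/-- Adjacency as a relation between natural numbers. -/
def NatAdj (G : SimpleGraph (Fin n)) (u v : ℕ) : Prop :=
  ∃ (hu : u < n) (hv : v < n), G.Adj ⟨u, hu⟩ ⟨v, hv⟩

theorem natAdj_iff {u v : Fin n} : NatAdj G u v ↔ G.Adj u v :=
  ⟨fun ⟨_, _, h⟩ => h, fun h => ⟨u.2, v.2, h⟩⟩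

theorem inputMemory_ne_zero_iff {χ Δ u v : ℕ} (hv : v < n) :
    G.inputMemory χ Δ (u * n + v + 3) ≠ 0 ↔ NatAdj G u v := by
  simp only [SimpleGraph.inputMemory, ne_eq, ite_eq_right_iff, one_ne_zero, imp_false, not_not]
  constructor
  · rintro ⟨a, b, hab, h⟩
    have hn : 0 < n := by omega
    have e1 := congrArg (· / n) hab
    have e2 := congrArg (· % n) hab
    simp only [Nat.mul_comm _ n, Nat.mul_add_div hn, Nat.mul_add_mod, Nat.div_eq_of_lt hv,
      Nat.div_eq_of_lt b.2, Nat.mod_eq_of_lt hv, Nat.mod_eq_of_lt b.2, add_zero] at e1 e2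
    subst e1 e2
    exact natAdj_iff.mpr h
  · rintro ⟨hu, hv, h⟩
    exact ⟨_, _, rfl, h⟩

theorem inputMemory_eq_zero {χ Δ a : ℕ} (ha : n * n ≤ a) : G.inputMemory χ Δ (a + 3) = 0 := by
  simp only [SimpleGraph.inputMemory, ite_eq_right_iff, one_ne_zero, imp_false, not_exists, not_and]
  intro u v h
  have h1 := Nat.mul_le_mul_right n (Nat.succ_le_of_lt u.2)
  rw [Nat.succ_mul] at h1
  have := v.2
  omega

/-- For u ≥ n the position lies beyond the matrix. The cases u = 0 and u = 1 concern registers 3 and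
n + 4, the scratch registers of `Program.relocate`. -/
theorem inputMemory_diag {χ Δ u : ℕ} : G.inputMemory χ Δ (u * n + u + 3) = 0 := by
  by_cases hu : u < n
  · by_contra h
    obtain ⟨_, _, h'⟩ := (inputMemory_ne_zero_iff hu).mp h
    exact G.loopless.irrefl _ h'
  · refine inputMemory_eq_zero ?_
    have := Nat.mul_le_mul_right n (not_lt.mp hu)
    omega

namespace Tabulated

variable {N χ Δ K S : ℕ} {inp : ℕ → ℕ} {ρ : Env} {𝕋 : Tables}

/-- Fewer than n vertices have been listed, so some vertex remains, and Dirac's theorem applies to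
the set of remaining vertices. -/
theorem eligible (h : Tabulated N n χ Δ K S inp ρ 𝕋) (hG : G.IsChordalGraph)
    (hinp : ∀ u, ∀ v < n, inp (u * n + v) ≠ 0 ↔ NatAdj G u v) {x : ℕ} (hx : x < n) :
    Eligible N n inp 𝕋 x (𝕋 1 (ix N x 0 0)) := by
  classical
  refine h.order_spec hx ?_
  obtain ⟨v, hv, hs⟩ := hG.exists_simplicial
    (Finset.univ.filter fun u : Fin n => Remains N n 𝕋 x u) (by
      by_contra hc
      rw [Finset.not_nonempty_iff_eq_empty, Finset.filter_eq_empty_iff] at hc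
      have : Finset.range n ⊆ (Finset.range x).image fun t => 𝕋 1 (ix N t 0 0) := by
        intro u hu
        rw [Finset.mem_range] at hu
        have := hc (Finset.mem_univ ⟨u, hu⟩)
        simp only [Remains, hu, true_and, not_forall, not_not] at this
        obtain ⟨t, ht, ht'⟩ := this
        exact Finset.mem_image.mpr ⟨t, Finset.mem_range.mpr ht, ht'⟩
      have := (Finset.card_le_card this).trans Finset.card_image_le
      simp only [Finset.card_range] at this
      omega)
  simp only [Finset.mem_filter, Finset.mem_univ, true_and] at hv hs
  refine ⟨v, hv, fun a b ha hb hva hvb hab => ?_⟩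
  rw [hinp _ _ ha.1] at hva
  rw [hinp _ _ hb.1] at hvb ⊢
  obtain ⟨_, ha', hva⟩ := hva
  obtain ⟨_, hb', hvb⟩ := hvb
  exact ⟨ha', hb', hs ⟨a, ha'⟩ ha ⟨b, hb'⟩ hb hva hvb (by simpa using hab)⟩

/-- The elimination order as a permutation of the vertices. -/
theorem exists_order (h : Tabulated N n χ Δ K S inp ρ 𝕋) (hG : G.IsChordalGraph)
    (hinp : ∀ u, ∀ v < n, inp (u * n + v) ≠ 0 ↔ NatAdj G u v) :
    ∃ e : Fin n ≃ Fin n, (∀ i j : Fin n, OrderedAdj N 𝕋 i j ↔ G.Adj (e i) (e j)) ∧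
      ∀ i j l : Fin n, i < j → i < l → G.Adj (e i) (e j) → G.Adj (e i) (e l) → j ≠ l →
        G.Adj (e j) (e l) := by
  have hel := fun (i : Fin n) => h.eligible hG hinp i.2
  let f : Fin n → Fin n := fun i => ⟨𝕋 1 (ix N i 0 0), (hel i).1.1⟩
  have hf : Function.Injective f := by
    intro i j hij
    have hij' : 𝕋 1 (ix N i 0 0) = 𝕋 1 (ix N j 0 0) := congrArg Fin.val hij
    rcases lt_trichotomy i j with hlt | heq | hlt
    · exact absurd hij' ((hel j).1.2 i hlt)
    · exact heq
    · exact absurd hij'.symm ((hel i).1.2 j hlt)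
  refine ⟨Equiv.ofBijective f (Finite.injective_iff_bijective.mp hf), fun i j => ?_,
    fun i j l hij hil hj hl hjl => ?_⟩
  · rw [h.orderedAdj_spec i.2 j.2 (hel i).1.1, hinp _ _ (hel j).1.1]
    exact natAdj_iff (u := f i) (v := f j)
  · simp only [Equiv.ofBijective_apply] at hj hl ⊢
    have hrem : ∀ j : Fin n, i < j → Remains N n 𝕋 i (f j) := fun j hij =>
      ⟨(f j).2, fun t ht => (hel j).1.2 t (ht.trans hij)⟩
    have := (hel i).2 (f j) (f l) (hrem j hij) (hrem l hil)
    rw [hinp _ _ (f j).2, hinp _ _ (f l).2, hinp _ _ (f l).2] at this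
    refine natAdj_iff.mp (this (natAdj_iff (u := f i).mpr hj) (natAdj_iff (u := f i).mpr hl) ?_)
    exact fun hc => hjl (hf (Fin.ext hc))

theorem orderedAdj_symm {e : Fin n ≃ Fin n}
    (he : ∀ i j : Fin n, OrderedAdj N 𝕋 i j ↔ G.Adj (e i) (e j)) {u v : ℕ} (hu : u < n) (hv : v < n)
    (h : OrderedAdj N 𝕋 u v) : OrderedAdj N 𝕋 v u :=
  (he ⟨v, hv⟩ ⟨u, hu⟩).mpr ((he ⟨u, hu⟩ ⟨v, hv⟩).mp h).symm

theorem orderedAdj_peo {e : Fin n ≃ Fin n}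
    (he : ∀ i j : Fin n, OrderedAdj N 𝕋 i j ↔ G.Adj (e i) (e j))
    (hpeo : ∀ i j l : Fin n, i < j → i < l → G.Adj (e i) (e j) → G.Adj (e i) (e l) → j ≠ l →
        G.Adj (e j) (e l)) {i j l : ℕ} (hj : Later n (OrderedAdj N 𝕋) i j)
    (hl : Later n (OrderedAdj N 𝕋) i l) (hjl : j ≠ l) : OrderedAdj N 𝕋 j l := by
  have hi : i < n := hj.1.trans hj.2.1
  exact (he ⟨j, hj.2.1⟩ ⟨l, hl.2.1⟩).mpr (hpeo ⟨i, hi⟩ ⟨j, hj.2.1⟩ ⟨l, hl.2.1⟩ hj.1 hl.1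
    ((he ⟨i, hi⟩ ⟨j, hj.2.1⟩).mp hj.2.2) ((he ⟨i, hi⟩ ⟨l, hl.2.1⟩).mp hl.2.2) (by simpa using hjl))

/-- Bags are cliques. -/
theorem orderedAdj_of_bag {e : Fin n ≃ Fin n}
    (he : ∀ i j : Fin n, OrderedAdj N 𝕋 i j ↔ G.Adj (e i) (e j))
    (hpeo : ∀ i j l : Fin n, i < j → i < l → G.Adj (e i) (e j) → G.Adj (e i) (e l) → j ≠ l →
        G.Adj (e j) (e l)) {w u v : ℕ} (hw : w < n) (hu : Bag n (OrderedAdj N 𝕋) w u)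
    (hv : Bag n (OrderedAdj N 𝕋) w v) (huv : u ≠ v) : OrderedAdj N 𝕋 u v := by
  rcases hu with rfl | hu <;> rcases hv with rfl | hv
  · exact absurd rfl huv
  · exact hv.2.2
  · exact orderedAdj_symm he hw hu.2.1 hu.2.2
  · exact orderedAdj_peo he hpeo hu hv huv

/-- A bag is a clique and the slots form a proper coloring, so the digits of a state serve the
vertices of a bag without conflict. -/
theorem slot_injOn (h : Tabulated N n χ Δ K S inp ρ 𝕋) {e : Fin n ≃ Fin n}
    (he : ∀ i j : Fin n, OrderedAdj N 𝕋 i j ↔ G.Adj (e i) (e j))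
    (hpeo : ∀ i j l : Fin n, i < j → i < l → G.Adj (e i) (e j) → G.Adj (e i) (e l) → j ≠ l →
        G.Adj (e j) (e l)) {w u v : ℕ} (hw : w < n) (hu : Bag n (OrderedAdj N 𝕋) w u)
    (hv : Bag n (OrderedAdj N 𝕋) w v) (huv : slot N n 𝕋 u = slot N n 𝕋 v) : u = v := by
  by_contra hne
  have hun := DynamicProgram.bag_lt hw hu
  have hvn := DynamicProgram.bag_lt hw hv
  rcases lt_or_gt_of_ne hne with hlt | hlt
  · exact (h.slot_spec hun).1 v ⟨hlt, hvn, orderedAdj_of_bag he hpeo hw hu hv hne⟩ huv.symm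
  · exact (h.slot_spec hvn).1 u ⟨hlt, hun, orderedAdj_of_bag he hpeo hw hv hu (Ne.symm hne)⟩ huv

theorem dynamicProgram (h : Tabulated N n χ Δ K S inp ρ 𝕋) {e : Fin n ≃ Fin n}
    (he : ∀ i j : Fin n, OrderedAdj N 𝕋 i j ↔ G.Adj (e i) (e j))
    (hpeo : ∀ i j l : Fin n, i < j → i < l → G.Adj (e i) (e j) → G.Adj (e i) (e l) → j ≠ l →
        G.Adj (e j) (e l)) (hslot : ∀ v < n, slot N n 𝕋 v < K) :
    DynamicProgram n χ Δ S (OrderedAdj N 𝕋) (fun s u => 𝕋 10 (ix N s u 0))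
      (fun s u => 𝕋 11 (ix N s u 0)) (fun v => 𝕋 4 (ix N v 0 0))
      (fun t w s => 𝕋 12 (ix N t w s) ≠ 0) where
  symm _ hu _ hv := orderedAdj_symm he hu hv
  irrefl u hu hc := G.loopless.irrefl _ ((he ⟨u, hu⟩ ⟨u, hu⟩).mp hc)
  peo _ _ _ := orderedAdj_peo he hpeo
  par_spec _ hv := h.parent_spec hv
  state_le s hs u hu := by
    rw [h.color_spec hs hu (hslot u hu), h.degree_spec hs hu (hslot u hu)]
    have hK := h.hK
    have := Nat.mod_lt (s / K ^ slot N n 𝕋 u) h.K_pos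
    refine ⟨Nat.div_lt_of_lt_mul ?_, Nat.lt_succ_iff.mp (Nat.mod_lt _ (by omega))⟩
    rwa [mul_comm, ← hK]
  exists_state w hw f g hfg := by
    classical
    -- The digit at an occupied slot packs the prescribed color and count of the vertex there, which
    -- is unique in the bag; unoccupied slots get 0.
    let δ : ℕ → ℕ := fun j => if hj : ∃ u, Bag n (OrderedAdj N 𝕋) w u ∧ slot N n 𝕋 u = j then
      (Δ + 1) * f hj.choose + g hj.choose else 0
    have hδ : ∀ j, δ j < K := by
      intro j
      simp only [δ]
      split_ifs with hj
      · obtain ⟨h1, h2⟩ := hfg _ hj.choose_spec.1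
        have := Nat.mul_le_mul_left (Δ + 1) (Nat.succ_le_of_lt h1)
        rw [Nat.mul_succ, Nat.mul_comm _ χ, ← h.hK] at this
        omega
      · exact h.K_pos
    obtain ⟨s, hs, hs'⟩ := exists_digits h.K_pos δ hδ K
    rw [← h.hS] at hs
    refine ⟨s, hs, fun u hu => ?_⟩
    have hun := DynamicProgram.bag_lt hw hu
    have hδu : δ (slot N n 𝕋 u) = (Δ + 1) * f u + g u := by
      have hj : ∃ u', Bag n (OrderedAdj N 𝕋) w u' ∧ slot N n 𝕋 u' = slot N n 𝕋 u := ⟨u, hu, rfl⟩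
      simp only [δ]
      rw [dif_pos hj, h.slot_injOn he hpeo hw hj.choose_spec.1 hu hj.choose_spec.2]
    have hg := Nat.lt_succ_iff.mpr (hfg u hu).2
    rw [h.color_spec hs hun (hslot u hun), h.degree_spec hs hun (hslot u hun),
      hs' _ (hslot u hun), hδu, Nat.mul_add_div (by omega), Nat.mul_add_mod,
      Nat.div_eq_of_lt hg, Nat.mod_eq_of_lt hg]
    exact ⟨rfl, rfl⟩
  zero _ hw _ hs := h.state_zero hw hs
  succ_par t ht w hw s hs hp := by
    rw [h.state_succ ht hw hs]
    simp only [hp, ne_eq, not_true_eq_false, false_and, or_false, true_and]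
  succ_ne t ht w hw s hs hp := by
    rw [h.state_succ ht hw hs]
    simp only [hp, ne_eq, not_false_eq_true, true_and, false_and, false_or]

open Classical in
/-- If the greedy coloring needs more than `K` colors, then the graph has a clique that is too large
for a defective coloring. -/
theorem slot_lt (h : Tabulated N n χ Δ K S inp ρ 𝕋) {e : Fin n ≃ Fin n}
    (he : ∀ i j : Fin n, OrderedAdj N 𝕋 i j ↔ G.Adj (e i) (e j))
    (hpeo : ∀ i j l : Fin n, i < j → i < l → G.Adj (e i) (e j) → G.Adj (e i) (e l) → j ≠ l →
        G.Adj (e j) (e l)) {C : ℕ → ℕ} (hC : ∀ u < n, C u < χ)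
    (hdeg : ∀ u < n, ((Finset.range n).filter fun x =>
      OrderedAdj N 𝕋 u x ∧ C x = C u).card ≤ Δ) {v : ℕ} (hv : v < n) : slot N n 𝕋 v < K := by
  by_contra hK
  rw [not_lt] at hK
  set Q := (Finset.range n).filter fun u => Bag n (OrderedAdj N 𝕋) v u with hQ
  have hcard : K + 1 ≤ Q.card := by
    rw [← Finset.card_range (K + 1)]
    -- The map sends v, whose slot is at least K, to K and every other vertex to its slot. The
    -- greedy rule yields all q < K among the later neighbors, so the bag has at least K + 1
    -- vertices.
    have hsub : Finset.range (K + 1) ⊆ Q.image fun u => min (slot N n 𝕋 u)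
        (if u = v then K else slot N n 𝕋 u) := by
      intro q hq
      rw [Finset.mem_range] at hq
      rw [Finset.mem_image]
      rcases (Nat.lt_succ_iff.mp hq).eq_or_lt with rfl | hq
      · exact ⟨v, Finset.mem_filter.mpr ⟨Finset.mem_range.mpr hv, .inl rfl⟩, by simp [hK]⟩
      · obtain ⟨u, hu, huq⟩ := (h.slot_spec hv).2 q (by omega)
        refine ⟨u, Finset.mem_filter.mpr ⟨Finset.mem_range.mpr hu.2.1, .inr hu⟩, ?_⟩
        rw [if_neg hu.1.ne', huq, min_self]
    exact (Finset.card_le_card hsub).trans Finset.card_image_le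
  -- More than χ(Δ + 1) vertices share χ colors, so some color occurs at least Δ + 2 times in the
  -- clique, and a vertex of that color has too many neighbors in its class.
  obtain ⟨i, -, hi⟩ := Finset.exists_lt_card_fiber_of_mul_lt_card_of_maps_to
    (s := Q) (t := Finset.range χ) (f := C) (n := Δ + 1)
    (fun u hu => Finset.mem_range.mpr (hC u (Finset.mem_range.mp (Finset.mem_filter.mp hu).1)))
    (by rw [Finset.card_range, ← h.hK]; omega)
  obtain ⟨u, hu⟩ : ((Q.filter fun x => C x = i)).Nonempty := Finset.card_pos.mp (by omega)
  have hu' := hu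
  simp only [hQ, Finset.mem_filter, Finset.mem_range] at hu'
  have hle : ((Q.filter fun x => C x = i).erase u).card ≤ Δ := by
    refine le_trans (Finset.card_le_card ?_) (hdeg u hu'.1.1)
    intro x hx
    simp only [hQ, Finset.mem_erase, Finset.mem_filter, Finset.mem_range] at hx ⊢
    exact ⟨hx.2.1.1, orderedAdj_of_bag he hpeo hv hu'.1.2 hx.2.1.2 hx.1.symm,
      hx.2.2.trans hu'.2.symm⟩
  rw [Finset.card_erase_of_mem hu] at hle
  omega

open Classical in
theorem hasDefectiveColoring_iff {e : Fin n ≃ Fin n}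
    (he : ∀ i j : Fin n, OrderedAdj N 𝕋 i j ↔ G.Adj (e i) (e j)) :
    G.HasDefectiveColoring χ Δ ↔ ∃ C : ℕ → ℕ, (∀ u < n, C u < χ) ∧
      ∀ u < n, ((Finset.range n).filter fun x => OrderedAdj N 𝕋 u x ∧ C x = C u).card ≤ Δ := by
  have key : ∀ (c : Fin n → Fin χ) (C : ℕ → ℕ), (∀ i : Fin n, C i = c (e i)) → ∀ i : Fin n,
      ((Finset.range n).filter fun x => OrderedAdj N 𝕋 i x ∧ C x = C i).card =
        (Finset.univ.filter fun x => G.Adj (e i) x ∧ c x = c (e i)).card := by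
    intro c C hc i
    rw [Finset.card_filter, Finset.card_filter, Finset.sum_range,
      ← Equiv.sum_comp e fun x => if G.Adj (e i) x ∧ c x = c (e i) then 1 else 0]
    refine Finset.sum_congr rfl fun j _ => if_congr (and_congr (he i j) ?_) rfl rfl
    rw [hc, hc, Fin.val_inj]
  constructor
  · rintro ⟨c, hc⟩
    rw [SimpleGraph.isDefectiveColoring_iff] at hc
    refine ⟨fun i => if hi : i < n then c (e ⟨i, hi⟩) else 0, fun u hu => by simp [hu],
      fun u hu => ?_⟩
    refine le_of_eq_of_le (key c _ (fun i => by simp) ⟨u, hu⟩) (hc _)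
  · rintro ⟨C, hC, hdeg⟩
    refine ⟨fun v => ⟨C (e.symm v), hC _ (e.symm v).2⟩, ?_⟩
    rw [SimpleGraph.isDefectiveColoring_iff]
    intro v
    have := key (fun v => ⟨C (e.symm v), hC _ (e.symm v).2⟩) C (by simp) (e.symm v)
    rw [Equiv.apply_symm_apply] at this
    rw [← this]
    exact hdeg _ (e.symm v).2

open Classical in
/-- The algorithm is correct. -/
theorem answer_eq (h : Tabulated N n χ Δ K S inp ρ 𝕋) (hG : G.IsChordalGraph)
    (hinp : ∀ u, ∀ v < n, inp (u * n + v) ≠ 0 ↔ NatAdj G u v) :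
    answerExpr.eval N 𝕋 ρ = if G.HasDefectiveColoring χ Δ then 1 else 0 := by
  obtain ⟨e, he, hpeo⟩ := h.exists_order hG hinp
  rw [h.answer_spec]
  refine if_congr ?_ rfl rfl
  rw [hasDefectiveColoring_iff he]
  constructor
  · rintro ⟨h1, h2⟩
    exact (h.dynamicProgram he hpeo h1).correct.mpr h2
  · rintro ⟨C, hC, hdeg⟩
    -- The slot test succeeds whenever a coloring exists, so answering 0 on its failure is right.
    have h1 : ∀ v < n, slot N n 𝕋 v < K := fun v hv => h.slot_lt he hpeo hC hdeg hv
    exact ⟨h1, (h.dynamicProgram he hpeo h1).correct.mp ⟨C, hC, hdeg⟩⟩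

end Tabulated

/-! ### The running time, and the theorem -/

/-- With q = χΔ, positivity of Δ gives K ≤ 2q, hence K ^ K ≤ (2q) ^ (2q) ≤ 4 · q ^ (4q) and N + 1 ≤
6(n + 1) · q ^ (4q). Raising this to the power c produces the factor c · 6 ^ c and the exponents 4cq
and c, all covered by the single constant c · 6 ^ c + 4c. -/
theorem time_bound {c n χ Δ : ℕ} (hχ : 0 < χ) (hΔ : 0 < Δ) :
    c * (n + (χ * (Δ + 1)) ^ (χ * (Δ + 1)) + 1 + 1) ^ c ≤
      (c * 6 ^ c + 4 * c) * (χ * Δ) ^ ((c * 6 ^ c + 4 * c) * (χ * Δ)) *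
        (n + 1) ^ (c * 6 ^ c + 4 * c) := by
  have hK : χ * (Δ + 1) ≤ 2 * (χ * Δ) := by nlinarith
  have hq : 0 < χ * Δ := Nat.mul_pos hχ hΔ
  generalize χ * Δ = q at *
  have hS : (χ * (Δ + 1)) ^ (χ * (Δ + 1)) ≤ 4 * q ^ (4 * q) := by
    calc (χ * (Δ + 1)) ^ (χ * (Δ + 1)) ≤ (2 * q) ^ (χ * (Δ + 1)) := Nat.pow_le_pow_left hK _
      _ ≤ (2 * q) ^ (2 * q) := Nat.pow_le_pow_right (by omega) hK
      _ ≤ 4 * q ^ (4 * q) := by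
        rcases (Nat.succ_le_of_lt hq).eq_or_lt with h1 | h2
        -- For q = 1 the left side is 2 ^ 2, which is why the factor 4 is needed; for q ≥ 2 the
        -- inequality 2q ≤ q ^ 2 suffices.
        · rw [← h1]; norm_num
        · calc (2 * q) ^ (2 * q) ≤ (q ^ 2) ^ (2 * q) :=
                Nat.pow_le_pow_left (by nlinarith) _
            _ = q ^ (4 * q) := by rw [← pow_mul]; congr 1; ring
            _ ≤ 4 * q ^ (4 * q) := by omega
  have hX : 1 ≤ q ^ (4 * q) := Nat.one_le_pow _ _ hq
  have hN : n + (χ * (Δ + 1)) ^ (χ * (Δ + 1)) + 1 + 1 ≤ 6 * (n + 1) * q ^ (4 * q) := by nlinarith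
  calc c * (n + (χ * (Δ + 1)) ^ (χ * (Δ + 1)) + 1 + 1) ^ c
      ≤ c * (6 * (n + 1) * q ^ (4 * q)) ^ c := Nat.mul_le_mul_left _ (Nat.pow_le_pow_left hN _)
    _ = (c * 6 ^ c) * q ^ (4 * c * q) * (n + 1) ^ c := by
      rw [mul_pow, mul_pow, ← pow_mul, show 4 * q * c = 4 * c * q by ring]; ring
    _ ≤ _ := by
      refine Nat.mul_le_mul (Nat.mul_le_mul (by omega) (Nat.pow_le_pow_right hq ?_))
        (Nat.pow_le_pow_right (by omega) (by omega))
      exact Nat.mul_le_mul_right _ (by omega)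

end DefectiveColoring

open RAM DefectiveColoring in
theorem mainTheorem8 :
    ∃ (P : RAM.Program) (C : ℕ),
      ∀ (n : ℕ) (G : SimpleGraph (Fin n)) (χ Δ : ℕ), 0 < χ → 0 < Δ → G.IsChordalGraph →
        ∃ (t : ℕ) (m : RAM.Memory),
          RAM.Runs P (G.inputMemory χ Δ) t m ∧
          t ≤ C * (χ * Δ) ^ (C * (χ * Δ)) * (n + 1) ^ C ∧
          (G.HasDefectiveColoring χ Δ → m 0 = 1) ∧
          (¬ G.HasDefectiveColoring χ Δ → m 0 = 0) := by
  obtain ⟨P, c, hP⟩ := exists_program (TStmt.fillAll tables) answerExpr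
  refine ⟨P, c * 6 ^ c + 4 * c, fun n G χ Δ hχ hΔ hG => ?_⟩
  have hK : 0 < χ * (Δ + 1) := by positivity
  obtain ⟨t, m, hrun, ht, ρ, 𝕋, hρ, h𝕋, hm⟩ := hP n χ Δ _ _ _
    (fun a => G.inputMemory χ Δ (a + 3)) (G.inputMemory χ Δ) rfl rfl rfl hK rfl rfl rfl
    (fun _ => rfl) (by simpa using inputMemory_diag (G := G) (χ := χ) (Δ := Δ) (u := 0))
    (by simpa [add_comm] using inputMemory_diag (G := G) (χ := χ) (Δ := Δ) (u := 1))
    (fun _ => inputMemory_eq_zero)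
  refine ⟨t, m, hrun, ht.trans (time_bound hχ hΔ), ?_⟩
  obtain ⟨h1, h2⟩ := TStmt.fillAll_spec
    (N := n + (χ * (Δ + 1)) ^ (χ * (Δ + 1)) + 1) (ρ := ρ) pairwise_tables 𝕋
  have htab : Tabulated (n + (χ * (Δ + 1)) ^ (χ * (Δ + 1)) + 1) n χ Δ (χ * (Δ + 1))
      ((χ * (Δ + 1)) ^ (χ * (Δ + 1))) (fun a => G.inputMemory χ Δ (a + 3)) ρ
      ((TStmt.fillAll tables).exec _ ρ 𝕋) :=
    ⟨hρ, (h1 0 (by simp [tables])).trans h𝕋, h2, rfl, rfl, rfl, hK⟩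
  rw [hm, htab.answer_eq hG fun u v hv => inputMemory_ne_zero_iff hv]
  exact ⟨fun h => if_pos h, fun h => if_neg h⟩
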